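/- Let $\mathbb D$ be the open unit disc, $\mathbb T$ the unit circle, $m$ the normalized arc-length measure on $\mathbb T$ and $dA=\frac{dx\,dy}{\pi}$ the normalized area measure on $\mathbb D$. Let $\mu$ be a positive Borel measure on $\mathbb D$ with $\int_{\mathbb D}(1-|w|^2)\,d\mu(w)<\infty$. For a holomorphic function $f$ on $\mathbb D$ put $$\mathcal D_\mu(f)=\int_{\mathbb D}|f'(z)|^2\,G_\mu(z)\,dA(z)\in[0,\infty],\qquad G_\mu(z)=\int_{\mathbb D}\log\left|\frac{1-\overline w z}{z-w}\right|^2d\mu(w).$$ For $w\in\mathbb D$ let $d\sigma_w(\zeta)=\frac{1-|w|^2}{|\zeta-w|^2}\,dm(\zeta)$ be the harmonic measure of $\mathbb D$ at $w$, and for $x,y\in\mathbb R$ let $F(x,y)=e^x-e^y-e^y(x-y)$, the Bregman divergence of the exponential function. Let $f$ belong to the Hardy space $H^2$ and be outer, that is, $$f(z)=\alpha\exp\left(\int_{\mathbb T}\frac{\zeta+z}{\zeta-z}\,h(\zeta)\,dm(\zeta)\right),\qquad z\in\mathbb D,$$ for some constant $\alpha$ with $|\alpha|=1$ and some real-valued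 $h\in L^1(\mathbb T,m)$. Write $f(\zeta)=\lim_{r\to1^-}f(r\zeta)$ for the radial limit, which exists for $m$-almost every $\zeta\in\mathbb T$. Then $$\mathcal D_\mu(f)=\int_{\mathbb D}\ \inf_{a\in\mathbb R}\int_{\mathbb T}F\bigl(2\log|f(\zeta)|,a\bigr)\,d\sigma_w(\zeta)\,d\mu(w),$$ as an identity in $[0,\infty]$ (both sides may be $+\infty$). -/

import Mathlib

open MeasureTheory
open scoped ENNReal Topology ComplexConjugate

noncomputable section

namespace DirichletOuter

/-- The open unit disc. -/
def disc : Set ℂ := Metric.ball 0 1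

/-- Normalized arc-length measure on the unit circle, as a Borel measure on `ℂ` carried by
the unit circle. -/
def m : Measure ℂ :=
  ENNReal.ofReal (2 * Real.pi)⁻¹ •
    (volume.restrict (Set.Ioc 0 (2 * Real.pi))).map (circleMap 0 1)

/-- Normalized area measure `dx dy / π` on the unit disc. -/
def area : Measure ℂ := ENNReal.ofReal Real.pi⁻¹ • volume.restrict disc

/-- The harmonic measure of the unit disc at `w`: Poisson kernel times arc length. -/
def σ (w : ℂ) : Measure ℂ :=
  m.withDensity fun ζ => ENNReal.ofReal ((1 - ‖w‖ ^ 2) / ‖ζ - w‖ ^ 2)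

/-- Membership in the Hardy space `H^p` of the unit disc, for `0 < p < ∞`. -/
def MemHardy (p : ℝ) (f : ℂ → ℂ) : Prop :=
  DifferentiableOn ℂ f disc ∧
    ∃ C : ℝ, ∀ r : ℝ, 0 ≤ r → r < 1 → Real.circleAverage (fun z => ‖f z‖ ^ p) 0 r ≤ C

/-- Outer functions: elements of `H^1` which are, up to a unimodular constant, the exponential
of the Herglotz integral of a real integrable function on the circle. -/
def IsOuter (f : ℂ → ℂ) : Prop :=
  MemHardy 1 f ∧
    ∃ (α : ℂ) (h : ℂ → ℝ), ‖α‖ = 1 ∧ Integrable h m ∧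
      ∀ z ∈ disc, f z = α * Complex.exp (∫ ζ, (ζ + z) / (ζ - z) * (h ζ : ℂ) ∂m)

/-- The radial limit of `f` at the boundary point `ζ`. -/
def boundaryValue (f : ℂ → ℂ) (ζ : ℂ) : ℂ :=
  Filter.limUnder (𝓝[<] (1 : ℝ)) fun r : ℝ => f ((r : ℂ) * ζ)

/-- Green kernel of the unit disc, with the normalization `log |(1 - \bar w z)/(z - w)|²` and
the value `∞` on the diagonal. -/
def greenKernel (z w : ℂ) : ℝ≥0∞ :=
  if z = w then ⊤ else ENNReal.ofReal (Real.log (‖(1 - conj w * z) / (z - w)‖ ^ 2))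

/-- Green potential of the restriction of `μ` to the unit disc. -/
def greenPotential (μ : Measure ℂ) (z : ℂ) : ℝ≥0∞ :=
  ∫⁻ w in disc, greenKernel z w ∂μ

/-- The weighted Dirichlet integral of `f` with weight `ω`. -/
def dirichletIntegral (ω : ℂ → ℝ≥0∞) (f : ℂ → ℂ) : ℝ≥0∞ :=
  ∫⁻ z, ENNReal.ofReal (‖deriv f z‖ ^ 2) * ω z ∂area

/-- The Bregman divergence of the exponential function; it is nonnegative. -/
def F (x y : ℝ) : ℝ := Real.exp x - Real.exp y - Real.exp y * (x - y)

end DirichletOuter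

end

/-! For an outer function `f` with `k = log |f|²` on the circle, `|f|²` is on the disc the
exponential of the Poisson integral of `k`. Since `F` is a Bregman divergence, the infimum over `a`
is attained at the mean of `k`, so it is the gap `∫ exp k dσ_w - |f w|²` in Jensen's inequality.
On the other side, the Littlewood–Paley identity expresses the Dirichlet integral of `f` weighted
by the Green kernel with pole `w` as the same gap: at the pole `0` both are sums of squared Taylor
coefficients, and the general pole is moved to `0` by a disc automorphism. Integrating over `w` by
Tonelli's theorem gives the identity.

The identity `∑ |aₙ|² = ∫ exp k dm` for the Taylor coefficients, finite or not, holds by Jensen's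
inequality in one direction and by Fatou's lemma along radii in the other. Radial limits of `f`
exist because `f` is a quotient of two bounded outer functions. -/

namespace DirichletOuter

open Filter Set
open scoped Real

/-! ### Harmonic measures of the disc -/

theorem mem_disc {z : ℂ} : z ∈ disc ↔ ‖z‖ < 1 := by simp [disc]

theorem zero_mem_disc : (0 : ℂ) ∈ disc := by simp [mem_disc]

theorem isOpen_disc : IsOpen disc := Metric.isOpen_ball

theorem measurableSet_disc : MeasurableSet disc := isOpen_disc.measurableSet

theorem radial_mem_disc {r : ℝ} (h0 : 0 ≤ r) (h1 : r < 1) {ζ : ℂ} (hζ : ‖ζ‖ = 1) :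
    (r : ℂ) * ζ ∈ disc := by
  simp [mem_disc, hζ, abs_of_nonneg h0, h1]

instance isProbabilityMeasure_m : IsProbabilityMeasure m := by
  constructor
  rw [m, Measure.smul_apply, Measure.map_apply (by fun_prop) MeasurableSet.univ]
  simp only [preimage_univ, Measure.restrict_apply MeasurableSet.univ, univ_inter,
    Real.volume_Ioc, sub_zero, smul_eq_mul]
  rw [← ENNReal.ofReal_mul (by positivity), inv_mul_cancel₀ (by positivity), ENNReal.ofReal_one]

theorem injOn_circleMap_Ioc : InjOn (circleMap 0 1) (Ioc 0 (2 * π)) := by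
  rw [← uIoc_of_le Real.two_pi_pos.le]
  exact injOn_circleMap_of_abs_sub_le one_ne_zero (by simp [abs_of_pos Real.pi_pos])

theorem ae_m_of_ae_angle {Q : ℂ → Prop}
    (hQ : ∀ᵐ θ ∂(volume : Measure ℝ), θ ∈ Ioc 0 (2 * π) → Q (circleMap 0 1 θ)) :
    ∀ᵐ ζ ∂m, Q ζ := by
  have hsphere : ∀ᵐ ζ ∂m, ζ ∈ circleMap 0 1 '' Ioc 0 (2 * π) := by
    refine Measure.ae_smul_measure ?_ _
    refine (ae_map_iff (by fun_prop)
      (measurableSet_Ioc.image_of_measurable_injOn (by fun_prop) injOn_circleMap_Ioc)).2 ?_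
    filter_upwards [ae_restrict_mem measurableSet_Ioc] with θ hθ using ⟨θ, hθ, rfl⟩
  obtain ⟨N, hN, hNm, hN0⟩ := exists_measurable_superset_of_null (ae_iff.1 hQ)
  have himg : MeasurableSet (circleMap 0 1 '' (N ∩ Ioc 0 (2 * π))) :=
    (hNm.inter measurableSet_Ioc).image_of_measurable_injOn (by fun_prop)
      (injOn_circleMap_Ioc.mono inter_subset_right)
  have hnull : m (circleMap 0 1 '' (N ∩ Ioc 0 (2 * π))) = 0 := by
    rw [m, Measure.smul_apply, Measure.map_apply (by fun_prop) himg,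
      Measure.restrict_apply (himg.preimage (by fun_prop))]
    refine smul_eq_zero_of_right _ (measure_mono_null ?_ hN0)
    rintro θ ⟨⟨θ', ⟨hθ'N, hθ'⟩, heq⟩, hθ⟩
    rwa [← injOn_circleMap_Ioc hθ' hθ heq]
  filter_upwards [hsphere, measure_eq_zero_iff_ae_notMem.1 hnull] with ζ hζ hζN
  obtain ⟨θ, hθ, rfl⟩ := hζ
  by_contra hq
  exact hζN ⟨θ, ⟨hN (by simpa using ⟨hθ.1, hθ.2, hq⟩), hθ⟩, rfl⟩

theorem ae_m_norm_eq_one : ∀ᵐ ζ ∂m, ‖ζ‖ = 1 :=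
  ae_m_of_ae_angle (.of_forall fun θ _ => by simp)

section

variable {E : Type*} [NormedAddCommGroup E]

theorem intervalIntegrable_of_integrable_m {u : ℂ → E} (hu : Integrable u m) :
    IntervalIntegrable (fun θ => u (circleMap 0 1 θ)) volume 0 (2 * π) := by
  rw [m, integrable_smul_measure (by simp [Real.pi_pos]) (by simp)] at hu
  rw [intervalIntegrable_iff_integrableOn_Ioc_of_le Real.two_pi_pos.le]
  exact hu.comp_measurable (by fun_prop)

theorem integrable_m_of_continuousOn {u : ℂ → E} (hu : ContinuousOn u (Metric.sphere 0 1)) :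
    Integrable u m := by
  have hr : m.restrict (Metric.sphere 0 1) = m :=
    Measure.restrict_eq_self_of_ae_mem (by simpa using ae_m_norm_eq_one)
  rw [← hr]
  exact hu.integrableOn_compact (isCompact_sphere _ _)

theorem integral_m [NormedSpace ℝ E] {u : ℂ → E} (hu : AEStronglyMeasurable u m) :
    ∫ ζ, u ζ ∂m = Real.circleAverage u 0 1 := by
  have hu' : AEStronglyMeasurable u ((volume.restrict (Ioc 0 (2 * π))).map (circleMap 0 1)) :=
    hu.mono_ac (Measure.absolutelyContinuous_smul (by simp [Real.pi_pos]))
  rw [m, integral_smul_measure, integral_map (by fun_prop) hu', Real.circleAverage_def,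
    intervalIntegral.integral_of_le Real.two_pi_pos.le, ENNReal.toReal_ofReal (by positivity)]

end

/-- The Poisson kernel of the unit disc with pole `w`, the density of `σ w`. Mathlib's
`poissonKernel 0 w` has the numerator `‖ζ‖ ^ 2 - ‖w‖ ^ 2`, so the two agree for `‖ζ‖ = 1` only. -/
noncomputable def poisson (w ζ : ℂ) : ℝ := (1 - ‖w‖ ^ 2) / ‖ζ - w‖ ^ 2

@[fun_prop]
theorem measurable_poisson : Measurable fun p : ℂ × ℂ => poisson p.1 p.2 := by
  unfold poisson; fun_prop

theorem poisson_eq_poissonKernel (w : ℂ) {ζ : ℂ} (hζ : ‖ζ‖ = 1) :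
    poisson w ζ = poissonKernel 0 w ζ := by
  simp [poisson, poissonKernel, hζ]

theorem poisson_nonneg {w : ℂ} (hw : w ∈ disc) (ζ : ℂ) : 0 ≤ poisson w ζ := by
  have := mem_disc.1 hw
  exact div_nonneg (by nlinarith [norm_nonneg w]) (by positivity)

theorem poisson_le {w : ℂ} (hw : w ∈ disc) {ζ : ℂ} (hζ : ‖ζ‖ = 1) :
    poisson w ζ ≤ (1 - ‖w‖ ^ 2) / (1 - ‖w‖) ^ 2 := by
  have h1 : 0 < 1 - ‖w‖ := sub_pos.2 (mem_disc.1 hw)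
  have h2 : 1 - ‖w‖ ≤ ‖ζ - w‖ := by simpa [hζ] using norm_sub_norm_le ζ w
  unfold poisson
  gcongr
  nlinarith [norm_nonneg w]

theorem poisson_radial_comm (r : ℝ) {ζ ξ : ℂ} (hζ : ‖ζ‖ = 1) (hξ : ‖ξ‖ = 1) :
    poisson (r * ζ) ξ = poisson (r * ξ) ζ := by
  have hsq : ‖ξ - r * ζ‖ ^ 2 = ‖ζ - r * ξ‖ ^ 2 := by
    rw [← Complex.normSq_eq_norm_sq, ← Complex.normSq_eq_norm_sq, Complex.normSq_sub,
      Complex.normSq_sub]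
    simp only [Complex.normSq_eq_norm_sq, hζ, hξ, map_mul, Complex.conj_ofReal,
      Complex.mul_re, Complex.mul_im, Complex.ofReal_re, Complex.ofReal_im, Complex.conj_re,
      Complex.conj_im]
    ring
  simp [poisson, hsq, hζ, hξ]

theorem σ_eq_withDensity (w : ℂ) : σ w = m.withDensity fun ζ => ENNReal.ofReal (poisson w ζ) := rfl

theorem σ_zero : σ 0 = m := by
  rw [σ_eq_withDensity, withDensity_congr_ae (g := 1) ?_, withDensity_one]
  filter_upwards [ae_m_norm_eq_one] with ζ hζ
  simp [poisson, hζ]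

theorem σ_absolutelyContinuous (w : ℂ) : σ w ≪ m := withDensity_absolutelyContinuous _ _

theorem ae_σ_norm_eq_one (w : ℂ) : ∀ᵐ ζ ∂(σ w), ‖ζ‖ = 1 :=
  (σ_absolutelyContinuous w).ae_le ae_m_norm_eq_one

section

variable {w : ℂ} {E : Type*} [NormedAddCommGroup E]

theorem σ_le (hw : w ∈ disc) : σ w ≤ ENNReal.ofReal ((1 - ‖w‖ ^ 2) / (1 - ‖w‖) ^ 2) • m := by
  rw [← withDensity_const]
  refine withDensity_mono ?_
  filter_upwards [ae_m_norm_eq_one] with ζ hζ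
  exact ENNReal.ofReal_le_ofReal (poisson_le hw hζ)

theorem integrable_σ (hw : w ∈ disc) {u : ℂ → E} (hu : Integrable u m) : Integrable u (σ w) :=
  (hu.smul_measure ENNReal.ofReal_ne_top).mono_measure (σ_le hw)

theorem integral_σ [NormedSpace ℝ E] (hw : w ∈ disc) (u : ℂ → E) :
    ∫ ζ, u ζ ∂(σ w) = ∫ ζ, poisson w ζ • u ζ ∂m := by
  rw [σ_eq_withDensity, integral_withDensity_eq_integral_toReal_smul (by fun_prop) (by simp)]
  simp [ENNReal.toReal_ofReal (poisson_nonneg hw _)]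

theorem integral_σ_of_diffContOnCl {q : ℂ → ℂ} (hq : DiffContOnCl ℂ q (Metric.ball 0 1))
    (hw : w ∈ disc) : ∫ ζ, q ζ ∂(σ w) = q w := by
  have hi : Integrable q m := integrable_m_of_continuousOn
    (hq.continuousOn_ball.mono Metric.sphere_subset_closedBall)
  have hP : Measurable (poisson w) := by fun_prop
  rw [integral_σ hw, integral_m (u := fun ζ => poisson w ζ • q ζ)
    (hP.aestronglyMeasurable.smul hi.1), ← hq.circleAverage_poissonKernel_smul hw]
  refine Real.circleAverage_congr_sphere fun ζ hζ => ?_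
  simp [poisson_eq_poissonKernel w (show ‖ζ‖ = 1 by simpa using hζ)]

theorem isProbabilityMeasure_σ (hw : w ∈ disc) : IsProbabilityMeasure (σ w) := by
  have h := integral_σ_of_diffContOnCl (q := fun _ => 1) diffContOnCl_const hw
  rw [integral_const, Complex.real_smul, mul_one] at h
  refine ⟨(ENNReal.toReal_eq_one_iff _).1 ?_⟩
  exact_mod_cast h

end

theorem lintegral_lintegral_σ_radial {r : ℝ} (h0 : 0 ≤ r) (h1 : r < 1) {u : ℂ → ℝ≥0∞}
    (hu : AEMeasurable u m) : ∫⁻ ζ, ∫⁻ ξ, u ξ ∂(σ (r * ζ)) ∂m = ∫⁻ ξ, u ξ ∂m := by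
  have hP : Measurable fun p : ℂ × ℂ => ENNReal.ofReal (poisson (r * p.1) p.2) := by fun_prop
  calc ∫⁻ ζ, ∫⁻ ξ, u ξ ∂(σ (r * ζ)) ∂m
      = ∫⁻ ζ, ∫⁻ ξ, ENNReal.ofReal (poisson (r * ζ) ξ) * u ξ ∂m ∂m := by
        refine lintegral_congr fun ζ => ?_
        rw [σ_eq_withDensity, lintegral_withDensity_eq_lintegral_mul₀ (by fun_prop) hu]
        rfl
    _ = ∫⁻ ξ, (∫⁻ ζ, ENNReal.ofReal (poisson (r * ζ) ξ) ∂m) * u ξ ∂m := by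
        rw [lintegral_lintegral_swap (hP.aemeasurable.mul hu.comp_snd)]
        exact lintegral_congr fun ξ => lintegral_mul_const _ (by fun_prop)
    _ = ∫⁻ ξ, u ξ ∂m := by
        refine lintegral_congr_ae ?_
        filter_upwards [ae_m_norm_eq_one] with ξ hξ
        have hone : ∫⁻ ζ, ENNReal.ofReal (poisson (r * ζ) ξ) ∂m = σ (r * ξ) univ := by
          rw [σ_eq_withDensity, withDensity_apply _ MeasurableSet.univ, setLIntegral_univ]
          refine lintegral_congr_ae ?_
          filter_upwards [ae_m_norm_eq_one] with ζ hζ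
          rw [poisson_radial_comm r hζ hξ]
        have := isProbabilityMeasure_σ (radial_mem_disc h0 h1 hξ)
        rw [hone, measure_univ, one_mul]

/-! ### Fatou's theorem on radial limits of Poisson integrals -/

/-- The Poisson kernel at a point of modulus `r`, as a function of the angle measured from the
direction of that point. -/
noncomputable def anglePoisson (r t : ℝ) : ℝ := (1 - r ^ 2) / (1 - 2 * r * Real.cos t + r ^ 2)

/-- The derivative of `anglePoisson r`. -/
noncomputable def anglePoissonDeriv (r t : ℝ) : ℝ :=
  -((1 - r ^ 2) * (2 * r * Real.sin t)) / (1 - 2 * r * Real.cos t + r ^ 2) ^ 2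

/-- The normalized kernel `-t ∂P/∂t`, for the Poisson kernel `P` in angular coordinates: an
approximate identity against which the difference quotients of a primitive are integrated. -/
noncomputable def fatouKernel (r t : ℝ) : ℝ := (2 * π)⁻¹ * -(t * anglePoissonDeriv r t)

theorem Ioo_zero_one_mem : Ioo (0 : ℝ) 1 ∈ 𝓝[<] (1 : ℝ) := Ioo_mem_nhdsLT one_pos

theorem norm_circleMap_sub_sq (r θ t : ℝ) :
    ‖circleMap 0 1 (θ + t) - r * circleMap 0 1 θ‖ ^ 2 = 1 - 2 * r * Real.cos t + r ^ 2 := by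
  have hfactor : circleMap 0 1 (θ + t) - r * circleMap 0 1 θ
      = circleMap 0 1 θ * (circleMap 0 1 t - r) := by
    simp only [circleMap, zero_add, Complex.ofReal_add, add_mul, Complex.exp_add]
    push_cast
    ring
  rw [hfactor, norm_mul, norm_circleMap_zero, abs_one, one_mul, ← Complex.normSq_eq_norm_sq,
    Complex.normSq_apply]
  simp only [circleMap, zero_add, Complex.ofReal_one, one_mul, Complex.sub_re, Complex.sub_im,
    Complex.exp_ofReal_mul_I_re, Complex.exp_ofReal_mul_I_im, Complex.ofReal_re, Complex.ofReal_im]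
  nlinarith [Real.sin_sq_add_cos_sq t]

theorem integral_σ_radial {u : ℂ → ℝ} (hu : AEStronglyMeasurable u m) {r : ℝ} (h0 : 0 ≤ r)
    (h1 : r < 1) (θ : ℝ) :
    ∫ ζ, u ζ ∂(σ (r * circleMap 0 1 θ)) =
      (2 * π)⁻¹ * ∫ t in -π..π, anglePoisson r t * u (circleMap 0 1 (θ + t)) := by
  set w : ℂ := r * circleMap 0 1 θ
  have hP : Measurable (poisson w) := by fun_prop
  have hper : Function.Periodic
      (fun s => poisson w (circleMap 0 1 s) • u (circleMap 0 1 s)) (2 * π) := fun s => by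
    simp only [periodic_circleMap 0 1 s]
  have hshift := hper.intervalIntegral_add_eq 0 (θ + -π)
  rw [zero_add, show θ + -π + 2 * π = θ + π by ring] at hshift
  rw [integral_σ (radial_mem_disc h0 h1 (by simp)), integral_m (u := fun ζ => poisson w ζ • u ζ)
    (hP.aestronglyMeasurable.smul hu), Real.circleAverage_def, smul_eq_mul, hshift,
    ← intervalIntegral.integral_comp_add_left]
  congr 1
  refine intervalIntegral.integral_congr fun t _ => ?_
  simp only [smul_eq_mul, poisson, anglePoisson, w, norm_circleMap_sub_sq, norm_mul,
    norm_circleMap_zero, Complex.norm_real, Real.norm_eq_abs, abs_one, mul_one, sq_abs]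

theorem neg_pi_le_pi : -π ≤ π := by linarith [Real.pi_pos]

section

variable {r : ℝ}

theorem anglePoisson_denom_pos (h0 : 0 ≤ r) (h1 : r < 1) (t : ℝ) :
    0 < 1 - 2 * r * Real.cos t + r ^ 2 := by
  nlinarith [Real.cos_le_one t, pow_pos (sub_pos.2 h1) 2]

theorem hasDerivAt_anglePoisson (h0 : 0 ≤ r) (h1 : r < 1) (t : ℝ) :
    HasDerivAt (anglePoisson r) (anglePoissonDeriv r t) t := by
  have h := (((Real.hasDerivAt_cos t).const_mul (2 * r)).const_sub 1).add_const (r ^ 2)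
  convert! (hasDerivAt_const t (1 - r ^ 2)).div h (anglePoisson_denom_pos h0 h1 t).ne' using 1
  rw [anglePoissonDeriv]
  congr 1
  ring

theorem contDiff_anglePoisson (h0 : 0 ≤ r) (h1 : r < 1) : ContDiff ℝ 1 (anglePoisson r) := by
  unfold anglePoisson
  exact ContDiff.div (by fun_prop) (by fun_prop) fun t => (anglePoisson_denom_pos h0 h1 t).ne'

theorem continuous_fatouKernel (h0 : 0 ≤ r) (h1 : r < 1) : Continuous (fatouKernel r) := by
  have : Continuous (anglePoissonDeriv r) :=
    Continuous.div (by fun_prop) (by fun_prop)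
      fun t => (pow_pos (anglePoisson_denom_pos h0 h1 t) 2).ne'
  unfold fatouKernel
  fun_prop

theorem anglePoisson_neg_pi (h0 : 0 ≤ r) : anglePoisson r (-π) = (1 - r) / (1 + r) := by
  rw [anglePoisson, Real.cos_neg, Real.cos_pi, div_eq_div_iff (by nlinarith) (by linarith)]
  ring

theorem anglePoisson_pi (h0 : 0 ≤ r) : anglePoisson r π = (1 - r) / (1 + r) := by
  rw [← anglePoisson_neg_pi h0]
  simp [anglePoisson]

theorem integral_anglePoisson (h0 : 0 ≤ r) (h1 : r < 1) :
    (2 * π)⁻¹ * ∫ t in -π..π, anglePoisson r t = 1 := by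
  have h := integral_σ_radial (u := fun _ => 1) aestronglyMeasurable_const h0 h1 0
  have := isProbabilityMeasure_σ (radial_mem_disc h0 h1 (ζ := circleMap 0 1 0) (by simp))
  simpa using h.symm

theorem integral_anglePoisson_mul (h0 : 0 ≤ r) (h1 : r < 1) {W : ℝ → ℝ}
    (hW : ∀ a b, IntervalIntegrable W volume a b) :
    ∫ t in -π..π, anglePoisson r t * W t = (1 - r) / (1 + r) * (∫ t in -π..π, W t) -
      ∫ t in -π..π, anglePoissonDeriv r t * ∫ s in 0..t, W s := by
  have hzero : (0 : ℝ) ∈ uIcc (-π) π :=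
    mem_uIcc_of_le (by linarith [Real.pi_pos]) Real.pi_pos.le
  have hparts := ((contDiff_anglePoisson h0 h1).contDiffOn.absolutelyContinuousOnInterval
    ).integral_mul_deriv_eq_deriv_mul
      ((hW (-π) π).absolutelyContinuousOnInterval_intervalIntegral hzero)
  have hderiv : ∫ t in -π..π, anglePoisson r t * deriv (fun t => ∫ s in 0..t, W s) t =
      ∫ t in -π..π, anglePoisson r t * W t := by
    refine intervalIntegral.integral_congr_ae ?_
    filter_upwards [(hW (-π) π).ae_hasDerivAt_integral] with t ht htm
    rw [(ht (uIoc_subset_uIcc htm) 0 hzero).deriv]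
  rw [← hderiv, hparts, anglePoisson_neg_pi h0, anglePoisson_pi h0, ← mul_sub,
    intervalIntegral.integral_interval_sub_left (hW _ _) (hW _ _)]
  congr 1
  exact intervalIntegral.integral_congr fun t _ => by
    simp only [(hasDerivAt_anglePoisson h0 h1 t).deriv]

theorem integral_anglePoisson_mul_eq_fatouKernel (h0 : 0 ≤ r) (h1 : r < 1) {W : ℝ → ℝ}
    (hW : ∀ a b, IntervalIntegrable W volume a b) :
    (2 * π)⁻¹ * ∫ t in -π..π, anglePoisson r t * W t =
      (1 - r) / (1 + r) * ((2 * π)⁻¹ * ∫ t in -π..π, W t) +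
        ∫ t in Icc (-π) π, fatouKernel r t • dslope (fun t => ∫ s in 0..t, W s) 0 t := by
  rw [integral_anglePoisson_mul h0 h1 hW, integral_Icc_eq_integral_Ioc,
    ← intervalIntegral.integral_of_le neg_pi_le_pi, mul_sub, sub_eq_add_neg]
  congr 1
  · ring
  rw [← intervalIntegral.integral_const_mul, ← intervalIntegral.integral_neg]
  refine intervalIntegral.integral_congr fun t _ => ?_
  have h := sub_smul_dslope (fun t => ∫ s in 0..t, W s) 0 t
  simp only [sub_zero, smul_eq_mul, intervalIntegral.integral_same] at h
  simp only [smul_eq_mul, fatouKernel, ← h]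
  ring

theorem integral_fatouKernel (h0 : 0 ≤ r) (h1 : r < 1) :
    ∫ t in Icc (-π) π, fatouKernel r t = 1 - (1 - r) / (1 + r) := by
  have h := integral_anglePoisson_mul h0 h1 (W := fun _ => 1) fun a b => by simp
  simp only [mul_one, intervalIntegral.integral_const, sub_zero, smul_eq_mul, sub_neg_eq_add] at h
  rw [integral_Icc_eq_integral_Ioc, ← intervalIntegral.integral_of_le neg_pi_le_pi]
  simp only [fatouKernel, intervalIntegral.integral_const_mul, intervalIntegral.integral_neg,
    mul_comm _ (anglePoissonDeriv r _)]
  have hone := integral_anglePoisson h0 h1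
  rw [h] at hone
  have hpi : (2 * π)⁻¹ * (π + π) = 1 := by field_simp; ring
  linear_combination hone - (1 - r) / (1 + r) * hpi

theorem fatouKernel_eq (r t : ℝ) : fatouKernel r t =
    (1 - r ^ 2) * (π⁻¹ * (r * (t * Real.sin t))) / (1 - 2 * r * Real.cos t + r ^ 2) ^ 2 := by
  rw [fatouKernel, anglePoissonDeriv]
  field_simp

theorem fatouKernel_nonneg (h0 : 0 ≤ r) (h1 : r < 1) {t : ℝ} (ht : t ∈ Icc (-π) π) :
    0 ≤ fatouKernel r t := by
  have hsin : 0 ≤ t * Real.sin t := by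
    rcases le_total 0 t with h | h
    · exact mul_nonneg h (Real.sin_nonneg_of_nonneg_of_le_pi h ht.2)
    · exact mul_nonneg_of_nonpos_of_nonpos h (Real.sin_nonpos_of_nonpos_of_neg_pi_le h ht.1)
  have hr : 0 ≤ 1 - r ^ 2 := by nlinarith
  rw [fatouKernel_eq]
  positivity

theorem fatouKernel_le {δ : ℝ} (h0 : 1 / 2 ≤ r) (h1 : r < 1) (hδ : 0 < δ) {t : ℝ}
    (ht : t ∈ Icc (-π) π) (hδt : δ ≤ |t|) :
    fatouKernel r t ≤ (1 - r ^ 2) / (2 / π ^ 2 * δ ^ 2) ^ 2 := by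
  have hr : 0 ≤ 1 - r ^ 2 := by nlinarith
  have hcos : 2 / π ^ 2 * δ ^ 2 ≤ 1 - Real.cos t :=
    calc 2 / π ^ 2 * δ ^ 2 ≤ 2 / π ^ 2 * t ^ 2 := by rw [← sq_abs t]; gcongr
      _ ≤ 1 - Real.cos t := by linarith [Real.cos_le_one_sub_mul_cos_sq (abs_le.2 ht)]
  have hden : 2 / π ^ 2 * δ ^ 2 ≤ 1 - 2 * r * Real.cos t + r ^ 2 := by
    nlinarith [sq_nonneg (1 - r), Real.cos_le_one t]
  have hnum : t * Real.sin t ≤ π :=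
    calc t * Real.sin t ≤ |t| * |Real.sin t| := (le_abs_self _).trans_eq (abs_mul _ _)
      _ ≤ π * 1 := by gcongr; exacts [abs_le.2 ht, Real.abs_sin_le_one t]
      _ = π := mul_one _
  rw [fatouKernel_eq]
  gcongr
  refine mul_le_of_le_one_right hr ?_
  rw [inv_mul_le_iff₀ Real.pi_pos, mul_one]
  nlinarith [Real.pi_pos]

end

theorem tendsto_one_sub_div_one_add :
    Tendsto (fun r : ℝ => (1 - r) / (1 + r)) (𝓝[<] 1) (𝓝 0) := by
  have h : ContinuousAt (fun r : ℝ => (1 - r) / (1 + r)) 1 :=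
    ContinuousAt.div (by fun_prop) (by fun_prop) (by norm_num)
  simpa using h.tendsto.mono_left nhdsWithin_le_nhds

theorem tendstoUniformlyOn_fatouKernel {u : Set ℝ} (hu : u ∈ 𝓝 0) :
    TendstoUniformlyOn fatouKernel 0 (𝓝[<] 1) (Icc (-π) π \ u) := by
  obtain ⟨δ, hδ, hball⟩ := Metric.mem_nhds_iff.1 hu
  rw [Metric.tendstoUniformlyOn_iff]
  intro ε hε
  have hbound : Tendsto (fun r : ℝ => (1 - r ^ 2) / (2 / π ^ 2 * δ ^ 2) ^ 2) (𝓝[<] 1) (𝓝 0) := by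
    have h : Continuous fun r : ℝ => (1 - r ^ 2) / (2 / π ^ 2 * δ ^ 2) ^ 2 := by fun_prop
    simpa using (h.tendsto 1).mono_left nhdsWithin_le_nhds
  filter_upwards [Ioo_mem_nhdsLT (by norm_num : (1 / 2 : ℝ) < 1),
    hbound.eventually_lt_const hε] with r hr hrε t ht
  have hδt : δ ≤ |t| := by
    by_contra hlt
    exact ht.2 (hball (by simpa using hlt))
  rw [Pi.zero_apply, dist_zero_left,
    Real.norm_of_nonneg (fatouKernel_nonneg (by linarith [hr.1]) hr.2 ht.1)]
  exact (fatouKernel_le hr.1.le hr.2 hδ ht.1 hδt).trans_lt hrε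

theorem tendsto_integral_fatouKernel_smul {φ : ℝ → ℝ} (hφ : ContinuousOn φ (Icc (-π) π)) :
    Tendsto (fun r => ∫ t in Icc (-π) π, fatouKernel r t • φ t) (𝓝[<] 1) (𝓝 (φ 0)) := by
  have hzero : (0 : ℝ) ∈ Icc (-π) π := ⟨by linarith [Real.pi_pos], Real.pi_pos.le⟩
  refine tendsto_setIntegral_peak_smul_of_integrableOn_of_tendsto measurableSet_Icc
    measurableSet_Icc subset_rfl self_mem_nhdsWithin (by simp) ?_
    (fun u hu h0 => tendstoUniformlyOn_fatouKernel (hu.mem_nhds h0)) ?_ ?_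
    (hφ.integrableOn_compact isCompact_Icc) (hφ 0 hzero)
  · filter_upwards [Ioo_zero_one_mem] with r hr t ht using fatouKernel_nonneg hr.1.le hr.2 ht
  · have h := tendsto_one_sub_div_one_add.const_sub 1
    rw [sub_zero] at h
    refine h.congr' ?_
    filter_upwards [Ioo_zero_one_mem] with r hr using (integral_fatouKernel hr.1.le hr.2).symm
  · filter_upwards [Ioo_zero_one_mem] with r hr
    exact (continuous_fatouKernel hr.1.le hr.2).aestronglyMeasurable

theorem tendsto_integral_anglePoisson_mul {W : ℝ → ℝ}
    (hW : ∀ a b, IntervalIntegrable W volume a b) {c : ℝ}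
    (hd : HasDerivAt (fun t => ∫ s in 0..t, W s) c 0) :
    Tendsto (fun r => (2 * π)⁻¹ * ∫ t in -π..π, anglePoisson r t * W t) (𝓝[<] 1) (𝓝 c) := by
  have hcont : ContinuousOn (dslope (fun t => ∫ s in 0..t, W s) 0) (Icc (-π) π) :=
    (continuousOn_dslope (Icc_mem_nhds (by linarith [Real.pi_pos]) Real.pi_pos)).2
      ⟨(intervalIntegral.continuous_primitive hW 0).continuousOn, hd.differentiableAt⟩
  have hsum := (tendsto_one_sub_div_one_add.mul_const ((2 * π)⁻¹ * ∫ t in -π..π, W t)).add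
    (tendsto_integral_fatouKernel_smul hcont)
  rw [zero_mul, zero_add, dslope_same, hd.deriv] at hsum
  refine hsum.congr' ?_
  filter_upwards [Ioo_zero_one_mem] with r hr
  exact (integral_anglePoisson_mul_eq_fatouKernel hr.1.le hr.2 hW).symm

theorem locallyIntegrable_of_intervalIntegrable {U : ℝ → ℝ}
    (hU : ∀ a b, IntervalIntegrable U volume a b) : LocallyIntegrable U volume := fun x =>
  ⟨Ioo (x - 1) (x + 1), Ioo_mem_nhds (by linarith) (by linarith),
    ((intervalIntegrable_iff_integrableOn_Ioo_of_le (by linarith)).1 (hU _ _))⟩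

theorem ae_tendsto_integral_σ_radial {u : ℂ → ℝ} (hu : Integrable u m) :
    ∀ᵐ ζ ∂m, Tendsto (fun r : ℝ => ∫ ξ, u ξ ∂(σ (r * ζ))) (𝓝[<] 1) (𝓝 (u ζ)) := by
  set U : ℝ → ℝ := fun θ => u (circleMap 0 1 θ)
  have hper : Function.Periodic U (2 * π) := fun s => by
    simp only [U, periodic_circleMap 0 1 s]
  have hint : ∀ a b, IntervalIntegrable U volume a b :=
    hper.intervalIntegrable₀ Real.two_pi_pos.ne' (intervalIntegrable_of_integrable_m hu)
  refine ae_m_of_ae_angle ?_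
  filter_upwards [LocallyIntegrable.ae_hasDerivAt_integral
    (locallyIntegrable_of_intervalIntegrable hint)]
    with θ hθ _
  have hd : HasDerivAt (fun t => ∫ s in 0..t, U (θ + s)) (U θ) 0 := by
    have h : HasDerivAt (fun x => ∫ s in θ..x, U s) (U θ) (θ + 0) := by simpa using hθ θ
    simpa [intervalIntegral.integral_comp_add_left] using h.comp_const_add θ 0
  have hW : ∀ a b, IntervalIntegrable (fun s => U (θ + s)) volume a b := fun a b => by
    simpa using (hint (θ + a) (θ + b)).comp_add_left θ
  refine (tendsto_integral_anglePoisson_mul hW hd).congr' ?_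
  filter_upwards [Ioo_zero_one_mem] with r hr
  exact (integral_σ_radial hu.1 hr.1.le hr.2 θ).symm

theorem ae_tendsto_integral_σ_radial_complex {u : ℂ → ℂ} (hu : Integrable u m) :
    ∀ᵐ ζ ∂m, Tendsto (fun r : ℝ => ∫ ξ, u ξ ∂(σ (r * ζ))) (𝓝[<] 1) (𝓝 (u ζ)) := by
  filter_upwards [ae_tendsto_integral_σ_radial hu.re, ae_tendsto_integral_σ_radial hu.im,
    ae_m_norm_eq_one] with ζ hre him hζ
  have h := hre.ofReal.add (him.ofReal.mul_const Complex.I)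
  rw [← Complex.re_add_im (u ζ)]
  refine h.congr' ?_
  filter_upwards [Ioo_zero_one_mem] with r hr
  exact integral_re_add_im (𝕜 := ℂ) (integrable_σ (radial_mem_disc hr.1.le hr.2 hζ) hu)

/-! ### Taylor coefficients and radial limits -/

/-- The `n`-th Taylor coefficient of `g` at the origin. -/
noncomputable def coeff (g : ℂ → ℂ) (n : ℕ) : ℂ := (n.factorial : ℂ)⁻¹ * iteratedDeriv n g 0

theorem coeff_zero (g : ℂ → ℂ) : coeff g 0 = g 0 := by simp [coeff]

theorem coeff_deriv (g : ℂ → ℂ) (n : ℕ) : coeff (deriv g) n = (n + 1) * coeff g (n + 1) := by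
  have h : (n.factorial : ℂ) ≠ 0 := by exact_mod_cast n.factorial_ne_zero
  have h' : (n + 1 : ℂ) ≠ 0 := by exact_mod_cast n.succ_ne_zero
  rw [coeff, coeff, iteratedDeriv_succ', Nat.factorial_succ]
  push_cast
  field_simp

/-- The partial sum of degree less than `N` of the power series with coefficients `c`. -/
noncomputable def truncation (c : ℕ → ℂ) (N : ℕ) : Polynomial ℂ :=
  ∑ n ∈ Finset.range N, Polynomial.monomial n (c n)

theorem eval_truncation (c : ℕ → ℂ) (N : ℕ) (z : ℂ) :
    (truncation c N).eval z = ∑ n ∈ Finset.range N, c n * z ^ n := by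
  simp [truncation, Polynomial.eval_finsetSum]

theorem coeff_truncation (c : ℕ → ℂ) (N n : ℕ) :
    (truncation c N).coeff n = if n < N then c n else 0 := by
  simp [truncation, Polynomial.coeff_monomial]

theorem integral_m_norm_sq_truncation (c : ℕ → ℂ) (N : ℕ) :
    ∫ ζ, ‖(truncation c N).eval ζ‖ ^ 2 ∂m = ∑ n ∈ Finset.range N, ‖c n‖ ^ 2 := by
  have hsub : (truncation c N).support ⊆ Finset.range N := fun n hn => by
    simp only [Polynomial.mem_support_iff, coeff_truncation, ne_eq, ite_eq_right_iff,
      Classical.not_imp] at hn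
    exact Finset.mem_range.2 hn.1
  rw [integral_m (u := fun ζ => ‖(truncation c N).eval ζ‖ ^ 2)
    (integrable_m_of_continuousOn (by fun_prop)).1,
    ← (truncation c N).sum_sq_norm_coeff_eq_circleAverage,
    Finset.sum_subset hsub fun n _ hn => by simpa using hn]
  refine Finset.sum_congr rfl fun n hn => ?_
  rw [coeff_truncation, if_pos (Finset.mem_range.1 hn)]

theorem hasSum_norm_sq_of_summable {c : ℕ → ℂ} (hc : Summable fun n => ‖c n‖) {G : ℂ → ℂ}
    (hG : ∀ ζ, ‖ζ‖ = 1 → HasSum (fun n => c n * ζ ^ n) (G ζ)) :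
    HasSum (fun n => ‖c n‖ ^ 2) (∫ ζ, ‖G ζ‖ ^ 2 ∂m) := by
  rw [hasSum_iff_tendsto_nat_of_nonneg fun n => by positivity]
  simp_rw [← integral_m_norm_sq_truncation]
  refine tendsto_integral_of_dominated_convergence (fun _ => (∑' n, ‖c n‖) ^ 2)
    (fun N => (integrable_m_of_continuousOn (by fun_prop)).1) (integrable_const _)
    (fun N => ?_) ?_
  · filter_upwards [ae_m_norm_eq_one] with ζ hζ
    rw [Real.norm_of_nonneg (by positivity), eval_truncation]
    gcongr
    refine (norm_sum_le _ _).trans ?_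
    simp only [norm_mul, norm_pow, hζ, one_pow, mul_one]
    exact hc.sum_le_tsum _ fun _ _ => norm_nonneg _
  · filter_upwards [ae_m_norm_eq_one] with ζ hζ
    simp_rw [eval_truncation]
    exact ((hG ζ hζ).tendsto_sum_nat.norm).pow 2

section

variable {g : ℂ → ℂ} (hg : DifferentiableOn ℂ g disc)
include hg

theorem hasSum_coeff {z : ℂ} (hz : z ∈ disc) : HasSum (fun n => coeff g n * z ^ n) (g z) := by
  convert! Complex.hasSum_taylorSeries_on_ball hg hz using 2 with n
  rw [coeff, sub_zero, smul_eq_mul, smul_eq_mul]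
  ring

theorem integrable_radial_norm_sq {r : ℝ} (h0 : 0 ≤ r) (h1 : r < 1) :
    Integrable (fun ζ => ‖g (r * ζ)‖ ^ 2) m :=
  integrable_m_of_continuousOn <| ContinuousOn.pow (ContinuousOn.norm <|
    hg.continuousOn.comp (by fun_prop) fun ζ hζ => radial_mem_disc h0 h1 (by simpa using hζ)) 2

theorem lintegral_radial_norm_sq {r : ℝ} (h0 : 0 ≤ r) (h1 : r < 1) :
    ∫⁻ ζ, ENNReal.ofReal (‖g (r * ζ)‖ ^ 2) ∂m =
      ∑' n, ENNReal.ofReal (‖coeff g n‖ ^ 2 * r ^ (2 * n)) := by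
  have hr : (r : ℂ) ∈ disc := by simpa using radial_mem_disc h0 h1 (ζ := 1) (by simp)
  have hsum := hasSum_norm_sq_of_summable (hasSum_coeff hg hr).summable.norm
    (G := fun ζ => g (r * ζ)) fun ζ hζ => by
      simpa only [mul_pow, mul_assoc] using hasSum_coeff hg (radial_mem_disc h0 h1 hζ)
  rw [← ofReal_integral_eq_lintegral_ofReal (integrable_radial_norm_sq hg h0 h1)
      (.of_forall fun _ => by positivity),
    ← hsum.tsum_eq, ENNReal.ofReal_tsum_of_nonneg (fun n => by positivity) hsum.summable]
  refine tsum_congr fun n => ?_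
  rw [norm_mul, norm_pow, Complex.norm_real, Real.norm_of_nonneg h0]
  ring_nf

theorem lintegral_radial_norm_sq_le {r : ℝ} (h0 : 0 ≤ r) (h1 : r < 1) :
    ∫⁻ ζ, ENNReal.ofReal (‖g (r * ζ)‖ ^ 2) ∂m ≤ ∑' n, ENNReal.ofReal (‖coeff g n‖ ^ 2) := by
  rw [lintegral_radial_norm_sq hg h0 h1]
  refine ENNReal.tsum_le_tsum fun n => ENNReal.ofReal_le_ofReal ?_
  exact mul_le_of_le_one_right (by positivity) (pow_le_one₀ h0 h1.le)

theorem lintegral_radialLimit_norm_sq_le {u : ℂ → ℝ}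
    (hu : ∀ᵐ ζ ∂m, Tendsto (fun r : ℝ => ‖g (r * ζ)‖ ^ 2) (𝓝[<] 1) (𝓝 (u ζ))) :
    ∫⁻ ζ, ENNReal.ofReal (u ζ) ∂m ≤ ∑' n, ENNReal.ofReal (‖coeff g n‖ ^ 2) := by
  obtain ⟨r, -, hr, hr1⟩ := exists_seq_strictMono_tendsto' (zero_lt_one' ℝ)
  have hr1' : Tendsto r atTop (𝓝[<] 1) :=
    tendsto_nhdsWithin_iff.2 ⟨hr1, .of_forall fun n => (hr n).2⟩
  calc ∫⁻ ζ, ENNReal.ofReal (u ζ) ∂m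
      = ∫⁻ ζ, liminf (fun n => ENNReal.ofReal (‖g (r n * ζ)‖ ^ 2)) atTop ∂m := by
        refine lintegral_congr_ae ?_
        filter_upwards [hu] with ζ hζ
        exact (ENNReal.tendsto_ofReal (hζ.comp hr1')).liminf_eq.symm
    _ ≤ liminf (fun n => ∫⁻ ζ, ENNReal.ofReal (‖g (r n * ζ)‖ ^ 2) ∂m) atTop :=
        lintegral_liminf_le' fun n =>
          (integrable_radial_norm_sq hg (hr n).1.le (hr n).2).aemeasurable.ennreal_ofReal
    _ ≤ ∑' n, ENNReal.ofReal (‖coeff g n‖ ^ 2) :=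
        (liminf_le_liminf (.of_forall fun n =>
          lintegral_radial_norm_sq_le hg (hr n).1.le (hr n).2)).trans_eq (liminf_const _)

theorem tsum_norm_coeff_sq_le {C : ℝ≥0∞}
    (hC : ∀ r ∈ Ioo (0 : ℝ) 1, ∫⁻ ζ, ENNReal.ofReal (‖g (r * ζ)‖ ^ 2) ∂m ≤ C) :
    ∑' n, ENNReal.ofReal (‖coeff g n‖ ^ 2) ≤ C := by
  rw [ENNReal.tsum_eq_iSup_sum]
  refine iSup_le fun s => ?_
  have hlim : Tendsto (fun r : ℝ => ∑ n ∈ s, ENNReal.ofReal (‖coeff g n‖ ^ 2 * r ^ (2 * n)))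
      (𝓝[<] 1) (𝓝 (∑ n ∈ s, ENNReal.ofReal (‖coeff g n‖ ^ 2))) := by
    have h : Continuous fun r : ℝ => ∑ n ∈ s, ENNReal.ofReal (‖coeff g n‖ ^ 2 * r ^ (2 * n)) :=
      continuous_finsetSum _ fun n _ => ENNReal.continuous_ofReal.comp (by fun_prop)
    simpa using (h.tendsto 1).mono_left nhdsWithin_le_nhds
  refine le_of_tendsto hlim ?_
  filter_upwards [Ioo_zero_one_mem] with r hr
  exact ((ENNReal.sum_le_tsum s).trans_eq (lintegral_radial_norm_sq hg hr.1.le hr.2).symm).trans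
    (hC r hr)

theorem summable_norm_coeff_sq_of_bounded {C : ℝ} (hC : ∀ z ∈ disc, ‖g z‖ ≤ C) :
    Summable fun n => ‖coeff g n‖ ^ 2 := by
  have hle : ∑' n, ENNReal.ofReal (‖coeff g n‖ ^ 2) ≤ ENNReal.ofReal (C ^ 2) := by
    refine tsum_norm_coeff_sq_le hg fun r hr => ?_
    calc ∫⁻ ζ, ENNReal.ofReal (‖g (r * ζ)‖ ^ 2) ∂m ≤ ∫⁻ _, ENNReal.ofReal (C ^ 2) ∂m := by
          refine lintegral_mono_ae ?_
          filter_upwards [ae_m_norm_eq_one] with ζ hζ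
          have := hC _ (radial_mem_disc hr.1.le hr.2 hζ)
          gcongr
      _ = ENNReal.ofReal (C ^ 2) := by simp
  have hsum := ENNReal.summable_toReal (ne_top_of_le_ne_top ENNReal.ofReal_ne_top hle)
  simpa only [ENNReal.toReal_ofReal (sq_nonneg _)] using hsum

end

theorem integral_conj_pow_mul_pow {ν : Measure ℂ} (hν : ∀ᵐ ζ ∂ν, ‖ζ‖ = 1) (i j : ℕ) :
    ∫ ζ, conj ζ ^ i * ζ ^ j ∂ν =
      if i ≤ j then ∫ ζ, ζ ^ (j - i) ∂ν else conj (∫ ζ, ζ ^ (i - j) ∂ν) := by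
  have hmul : ∀ᵐ ζ : ℂ ∂ν, conj ζ * ζ = 1 := by
    filter_upwards [hν] with ζ hζ
    simp [← Complex.normSq_eq_conj_mul_self, Complex.normSq_eq_norm_sq, hζ]
  split_ifs with hij
  · refine integral_congr_ae ?_
    filter_upwards [hmul] with ζ hζ
    rw [← Nat.add_sub_of_le hij, pow_add, ← mul_assoc, ← mul_pow, hζ, one_pow, one_mul,
      Nat.add_sub_cancel_left]
  · rw [← integral_conj]
    refine integral_congr_ae ?_
    filter_upwards [hmul] with ζ hζ
    rw [← Nat.sub_add_cancel (not_le.1 hij).le, pow_add, mul_assoc, ← mul_pow, hζ, one_pow,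
      mul_one, Nat.add_sub_cancel, map_pow]

theorem integral_pow_σ {z : ℂ} (hz : z ∈ disc) (n : ℕ) : ∫ ζ, ζ ^ n ∂(σ z) = z ^ n :=
  integral_σ_of_diffContOnCl (Differentiable.diffContOnCl (by fun_prop)) hz

theorem memLp_pow (n : ℕ) : MemLp (fun ζ : ℂ => ζ ^ n) 2 m := by
  refine .of_bound (by fun_prop) 1 ?_
  filter_upwards [ae_m_norm_eq_one] with ζ hζ
  simp [hζ]

theorem orthonormal_pow : Orthonormal ℂ fun n : ℕ => (memLp_pow n).toLp := by
  rw [orthonormal_iff_ite]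
  intro i j
  have hinner : inner ℂ (memLp_pow i).toLp (memLp_pow j).toLp = ∫ ζ, conj ζ ^ i * ζ ^ j ∂m := by
    rw [L2.inner_def]
    refine integral_congr_ae ?_
    filter_upwards [(memLp_pow i).coeFn_toLp, (memLp_pow j).coeFn_toLp] with ζ hi hj
    simp [hi, hj, mul_comm]
  rw [hinner, integral_conj_pow_mul_pow ae_m_norm_eq_one]
  simp_rw [← σ_zero, integral_pow_σ zero_mem_disc]
  rcases lt_trichotomy i j with h | rfl | h
  · simp [h.le, h.ne, (Nat.sub_pos_of_lt h).ne']
  · simp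
  · simp [h.not_ge, h.ne', (Nat.sub_pos_of_lt h).ne']

theorem memLp_poisson {z : ℂ} (hz : z ∈ disc) : MemLp (fun ζ => (poisson z ζ : ℂ)) 2 m := by
  refine .of_bound (by fun_prop) ((1 - ‖z‖ ^ 2) / (1 - ‖z‖) ^ 2) ?_
  filter_upwards [ae_m_norm_eq_one] with ζ hζ
  rw [Complex.norm_real, Real.norm_of_nonneg (poisson_nonneg hz ζ)]
  exact poisson_le hz hζ

theorem inner_poisson {z : ℂ} (hz : z ∈ disc) (u : Lp ℂ 2 m) :
    inner ℂ (memLp_poisson hz).toLp u = ∫ ζ, u ζ ∂(σ z) := by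
  rw [L2.inner_def, integral_σ hz]
  refine integral_congr_ae ?_
  filter_upwards [(memLp_poisson hz).coeFn_toLp] with ζ hζ
  simp [hζ, mul_comm]

theorem exists_integral_σ_eq {g : ℂ → ℂ} (hg : DifferentiableOn ℂ g disc)
    (hs : Summable fun n => ‖coeff g n‖ ^ 2) :
    ∃ u : ℂ → ℂ, Integrable u m ∧ ∀ z ∈ disc, g z = ∫ ζ, u ζ ∂(σ z) := by
  have hsum : Summable fun n => coeff g n • (memLp_pow n).toLp :=
    (orthonormal_pow.orthogonalFamily.summable_iff_norm_sq_summable (coeff g)).2 hs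
  refine ⟨_, (Lp.memLp (∑' n, coeff g n • (memLp_pow n).toLp)).integrable one_le_two,
    fun z hz => (hasSum_coeff hg hz).unique ?_⟩
  have h := (innerSL ℂ (memLp_poisson hz).toLp).hasSum hsum.hasSum
  simp only [map_smul, smul_eq_mul] at h
  simp only [innerSL_apply_apply, inner_poisson hz] at h
  refine h.congr_fun fun n => ?_
  rw [← integral_pow_σ hz]
  congr 1
  exact integral_congr_ae ((σ_absolutelyContinuous z).ae_le (memLp_pow n).coeFn_toLp.symm)

theorem ae_exists_tendsto_radial {g : ℂ → ℂ} (hg : DifferentiableOn ℂ g disc) {C : ℝ}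
    (hC : ∀ z ∈ disc, ‖g z‖ ≤ C) :
    ∀ᵐ ζ ∂m, ∃ l, Tendsto (fun r : ℝ => g (r * ζ)) (𝓝[<] 1) (𝓝 l) := by
  obtain ⟨u, hu, hgu⟩ := exists_integral_σ_eq hg (summable_norm_coeff_sq_of_bounded hg hC)
  filter_upwards [ae_tendsto_integral_σ_radial_complex hu, ae_m_norm_eq_one] with ζ hlim hζ
  refine ⟨u ζ, hlim.congr' ?_⟩
  filter_upwards [Ioo_zero_one_mem] with r hr
  exact (hgu _ (radial_mem_disc hr.1.le hr.2 hζ)).symm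

/-! ### Exponentials of Herglotz integrals -/

/-- The Herglotz integral of `h`: the holomorphic function on the disc with real part the Poisson
integral of `h` that is real at the origin. -/
noncomputable def herglotz (h : ℂ → ℝ) (z : ℂ) : ℂ := ∫ ζ, (ζ + z) / (ζ - z) * (h ζ : ℂ) ∂m

section

variable {h : ℂ → ℝ} (hh : Integrable h m)
include hh

theorem integrable_herglotz {z : ℂ} (hz : z ∈ disc) :
    Integrable (fun ζ => (ζ + z) / (ζ - z) * (h ζ : ℂ)) m := by
  have hz1 := mem_disc.1 hz
  refine hh.ofReal.bdd_mul (c := 2 / (1 - ‖z‖))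
    (Measurable.aestronglyMeasurable (by fun_prop)) ?_
  filter_upwards [ae_m_norm_eq_one] with ζ hζ
  have hnum : ‖ζ + z‖ ≤ 2 := (norm_add_le _ _).trans (by linarith)
  have hden : 1 - ‖z‖ ≤ ‖ζ - z‖ := by simpa [hζ] using norm_sub_norm_le ζ z
  have : 0 < 1 - ‖z‖ := sub_pos.2 hz1
  rw [norm_div]
  gcongr

theorem re_herglotz {z : ℂ} (hz : z ∈ disc) : (herglotz h z).re = ∫ ζ, h ζ ∂(σ z) := by
  rw [integral_σ hz]
  refine (integral_re (𝕜 := ℂ) (integrable_herglotz hh hz)).symm.trans (integral_congr_ae ?_)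
  filter_upwards [ae_m_norm_eq_one] with ζ hζ
  have hre := congrFun (poissonKernel_eq_re_herglotzRieszKernel (c := 0) (w := z)) ζ
  simp only [← poisson_eq_poissonKernel z hζ, herglotzRieszKernel, sub_zero,
    Function.comp_apply] at hre
  simp only [RCLike.re_eq_complex_re, Complex.re_mul_ofReal, smul_eq_mul, hre]

theorem norm_exp_herglotz {z : ℂ} (hz : z ∈ disc) :
    ‖Complex.exp (herglotz h z)‖ = Real.exp (∫ ζ, h ζ ∂(σ z)) := by
  rw [Complex.norm_exp, re_herglotz hh hz]

theorem differentiableOn_herglotz : DifferentiableOn ℂ (herglotz h) disc := by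
  refine (differentiableOn_circleAverage_herglotzRieszKernel_smul
    (f := fun ζ => (h ζ : ℂ)) ?_).congr fun z hz => ?_
  · exact intervalIntegrable_of_integrable_m (u := fun ζ => (h ζ : ℂ)) hh.ofReal
  · rw [herglotz, integral_m (u := fun ζ => (ζ + z) / (ζ - z) * (h ζ : ℂ))
      (integrable_herglotz hh hz).1]
    simp only [herglotzRieszKernel, sub_zero, smul_eq_mul]

theorem ae_tendsto_norm_exp_herglotz :
    ∀ᵐ ζ ∂m, Tendsto (fun r : ℝ => ‖Complex.exp (herglotz h (r * ζ))‖) (𝓝[<] 1)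
      (𝓝 (Real.exp (h ζ))) := by
  filter_upwards [ae_tendsto_integral_σ_radial hh, ae_m_norm_eq_one] with ζ hlim hζ
  refine (hlim.rexp).congr' ?_
  filter_upwards [Ioo_zero_one_mem] with r hr
  exact (norm_exp_herglotz hh (radial_mem_disc hr.1.le hr.2 hζ)).symm

theorem ae_exists_tendsto_exp_herglotz_of_nonpos (h0 : ∀ ζ, h ζ ≤ 0) :
    ∀ᵐ ζ ∂m, ∃ l ≠ 0, Tendsto (fun r : ℝ => Complex.exp (herglotz h (r * ζ))) (𝓝[<] 1) (𝓝 l) := by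
  have hbound : ∀ z ∈ disc, ‖Complex.exp (herglotz h z)‖ ≤ 1 := fun z hz => by
    rw [norm_exp_herglotz hh hz]
    exact Real.exp_le_one_iff.2 (integral_nonpos h0)
  filter_upwards [ae_exists_tendsto_radial (differentiableOn_herglotz hh).cexp hbound,
    ae_tendsto_norm_exp_herglotz hh] with ζ ⟨l, hl⟩ hnorm
  refine ⟨l, norm_ne_zero_iff.1 ?_, hl⟩
  rw [tendsto_nhds_unique hl.norm hnorm]
  exact (Real.exp_pos _).ne'

theorem ae_exists_tendsto_exp_herglotz :
    ∀ᵐ ζ ∂m, ∃ l, Tendsto (fun r : ℝ => Complex.exp (herglotz h (r * ζ))) (𝓝[<] 1) (𝓝 l) := by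
  -- Both factors of `exp H[h] = exp H[-h⁻] / exp H[-h⁺]` are bounded by `1`.
  have hneg : Integrable (fun ζ => -(h ζ)⁻) m := hh.neg_part.neg
  have hpos : Integrable (fun ζ => -(h ζ)⁺) m := hh.pos_part.neg
  filter_upwards [ae_m_norm_eq_one,
    ae_exists_tendsto_exp_herglotz_of_nonpos hneg fun ζ => neg_nonpos.2 (negPart_nonneg _),
    ae_exists_tendsto_exp_herglotz_of_nonpos hpos fun ζ => neg_nonpos.2 (posPart_nonneg _)]
    with ζ hζ ⟨l, _, hl⟩ ⟨k, hk0, hk⟩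
  refine ⟨l / k, (hl.div hk hk0).congr' ?_⟩
  filter_upwards [Ioo_zero_one_mem] with r hr
  have hz := radial_mem_disc hr.1.le hr.2 hζ
  simp only [Pi.div_apply]
  rw [← Complex.exp_sub, herglotz, herglotz, herglotz, ← integral_sub
    (integrable_herglotz hneg hz) (integrable_herglotz hpos hz)]
  congr 1
  refine integral_congr_ae (.of_forall fun ξ => ?_)
  have hsub : h ξ = -(h ξ)⁻ - -(h ξ)⁺ := by linarith [posPart_sub_negPart (h ξ)]
  simp only [← mul_sub, ← Complex.ofReal_sub, ← hsub]

theorem ae_norm_boundaryValue_eq_exp {f : ℂ → ℂ} {α : ℂ} (hα : ‖α‖ = 1)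
    (hf : ∀ z ∈ disc, f z = α * Complex.exp (herglotz h z)) :
    ∀ᵐ ζ ∂m, ‖boundaryValue f ζ‖ = Real.exp (h ζ) := by
  filter_upwards [ae_exists_tendsto_exp_herglotz hh, ae_tendsto_norm_exp_herglotz hh,
    ae_m_norm_eq_one] with ζ ⟨l, hl⟩ hnorm hζ
  have hlim : Tendsto (fun r : ℝ => f (r * ζ)) (𝓝[<] 1) (𝓝 (α * l)) := by
    refine (hl.const_mul α).congr' ?_
    filter_upwards [Ioo_zero_one_mem] with r hr
    exact (hf _ (radial_mem_disc hr.1.le hr.2 hζ)).symm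
  rw [boundaryValue, hlim.limUnder_eq, norm_mul, hα, one_mul]
  exact tendsto_nhds_unique hl.norm hnorm

end

/-! ### The Littlewood–Paley identity with pole at the origin -/

theorem lintegral_m {u : ℂ → ℝ≥0∞} (hu : Measurable u) :
    ∫⁻ ζ, u ζ ∂m = ENNReal.ofReal (2 * π)⁻¹ * ∫⁻ θ in Ioo (-π) π, u (circleMap 0 1 θ) := by
  have h := (isAddFundamentalDomain_Ioc Real.two_pi_pos 0).setLIntegral_eq
    (isAddFundamentalDomain_Ioc Real.two_pi_pos (-π)) (fun θ => u (circleMap 0 1 θ)) fun g θ => by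
      obtain ⟨_, k, rfl⟩ := g
      simp only [AddSubgroup.vadd_def, vadd_eq_add]
      rw [add_comm, (periodic_circleMap 0 1).zsmul k θ]
  rw [zero_add, show -π + 2 * π = π by ring] at h
  rw [m, lintegral_smul_measure, lintegral_map hu (by fun_prop), h, smul_eq_mul,
    setLIntegral_congr Ioo_ae_eq_Ioc]

theorem lintegral_volume_eq_polar {H : ℂ → ℝ≥0∞} (hH : Measurable H) :
    ∫⁻ z, H z = ∫⁻ r in Ioi (0 : ℝ), ENNReal.ofReal (2 * π * r) * ∫⁻ ζ, H (r * ζ) ∂m := by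
  have hpolar : ∀ p : ℝ × ℝ, Complex.polarCoord.symm p = p.1 * circleMap 0 1 p.2 := fun p => by
    simp [circleMap, Complex.exp_mul_I]
  rw [← Complex.lintegral_comp_polarCoord_symm, polarCoord_target, Measure.volume_eq_prod,
    ← Measure.prod_restrict, lintegral_prod _ (by simp only [hpolar, smul_eq_mul]; fun_prop)]
  refine lintegral_congr fun r => ?_
  simp only [smul_eq_mul, hpolar]
  rw [lintegral_const_mul _ (by fun_prop), lintegral_m (by fun_prop), ← mul_assoc,
    mul_comm (2 * π), ENNReal.ofReal_mul' (by positivity), mul_assoc (ENNReal.ofReal r),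
    ← ENNReal.ofReal_mul (by positivity), mul_inv_cancel₀ (by positivity), ENNReal.ofReal_one,
    mul_one]

theorem lintegral_area_eq_polar {H : ℂ → ℝ≥0∞} (hH : Measurable H) :
    ∫⁻ z, H z ∂area =
      ∫⁻ r in Ioo (0 : ℝ) 1, ENNReal.ofReal (2 * r) * ∫⁻ ζ, H (r * ζ) ∂m := by
  have hcircle : ∀ r ∈ Ioi (0 : ℝ), ENNReal.ofReal (2 * π * r) *
      ∫⁻ ζ, disc.indicator H (r * ζ) ∂m = (Iio (1 : ℝ)).indicator
        (fun r => ENNReal.ofReal (2 * π * r) * ∫⁻ ζ, H (r * ζ) ∂m) r := by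
    intro r h0
    have hmem : ∀ᵐ ζ ∂m, ((r : ℂ) * ζ ∈ disc ↔ r < 1) := by
      filter_upwards [ae_m_norm_eq_one] with ζ hζ
      simp [mem_disc, hζ, abs_of_pos (mem_Ioi.1 h0)]
    by_cases h1 : r < 1
    · rw [indicator_of_mem (mem_Iio.2 h1)]
      congr 1
      refine lintegral_congr_ae ?_
      filter_upwards [hmem] with ζ hζ using indicator_of_mem (hζ.2 h1) _
    · rw [indicator_of_notMem (by simpa using h1), lintegral_eq_zero_of_ae_eq_zero, mul_zero]
      filter_upwards [hmem] with ζ hζ using indicator_of_notMem (fun h => h1 (hζ.1 h)) _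
  rw [area, lintegral_smul_measure, ← lintegral_indicator measurableSet_disc,
    lintegral_volume_eq_polar (hH.indicator measurableSet_disc),
    setLIntegral_congr_fun measurableSet_Ioi hcircle, setLIntegral_indicator measurableSet_Iio,
    Iio_inter_Ioi, smul_eq_mul, ← lintegral_const_mul _ (by fun_prop)]
  refine lintegral_congr fun r => ?_
  rw [← mul_assoc, ← ENNReal.ofReal_mul (by positivity)]
  congr 2
  field_simp

theorem integral_pow_mul_log (n : ℕ) :
    ∫ r in (0 : ℝ)..1, -(4 * (n + 1) ^ 2 * (r ^ (2 * n) * (r * Real.log r))) = 1 := by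
  have : Continuous fun r : ℝ => r * Real.log r := Real.continuous_mul_log
  have hderiv : ∀ r ∈ Ioo (0 : ℝ) 1, HasDerivAt
      (fun r => r ^ (2 * n + 2) - 2 * (n + 1) * (r ^ (2 * n + 1) * (r * Real.log r)))
      (-(4 * (n + 1) ^ 2 * (r ^ (2 * n) * (r * Real.log r)))) r := by
    intro r hr
    have h := ((hasDerivAt_pow (2 * n + 1) r).mul
      ((hasDerivAt_id r).mul (Real.hasDerivAt_log hr.1.ne'))).const_mul (2 * (n + 1 : ℝ))
    convert! (hasDerivAt_pow (2 * n + 2) r).sub h using 1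
    have := hr.1.ne'
    simp only [Pi.mul_apply, id, Nat.add_sub_cancel, show 2 * n + 2 - 1 = 2 * n + 1 by omega]
    push_cast
    field_simp
    ring
  rw [intervalIntegral.integral_eq_sub_of_hasDerivAt_of_le zero_le_one (by fun_prop) hderiv
    (Continuous.intervalIntegrable (by fun_prop) _ _)]
  simp

theorem lintegral_pow_mul_log (n : ℕ) :
    ∫⁻ r in Ioo (0 : ℝ) 1, ENNReal.ofReal (2 * r) *
      (ENNReal.ofReal ((n + 1) ^ 2 * r ^ (2 * n)) * ENNReal.ofReal (-Real.log (r ^ 2))) = 1 := by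
  set φ : ℝ → ℝ := fun r => -(4 * (n + 1) ^ 2 * (r ^ (2 * n) * (r * Real.log r)))
  have hφ : Continuous φ := by
    have := Real.continuous_mul_log
    fun_prop
  have hφ_nonneg : ∀ r ∈ Ioo (0 : ℝ) 1, 0 ≤ φ r := fun r hr => by
    have hlog : r * Real.log r ≤ 0 :=
      mul_nonpos_of_nonneg_of_nonpos hr.1.le (Real.log_nonpos hr.1.le hr.2.le)
    exact neg_nonneg.2 (mul_nonpos_of_nonneg_of_nonpos (by positivity)
      (mul_nonpos_of_nonneg_of_nonpos (pow_nonneg hr.1.le _) hlog))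
  rw [setLIntegral_congr_fun (g := fun r => ENNReal.ofReal (φ r)) measurableSet_Ioo,
    ← ofReal_integral_eq_lintegral_ofReal, ← integral_Ioc_eq_integral_Ioo,
    ← intervalIntegral.integral_of_le zero_le_one, integral_pow_mul_log, ENNReal.ofReal_one]
  · exact (hφ.integrableOn_Icc (a := 0) (b := 1)).mono_set Ioo_subset_Icc_self
  · exact (ae_restrict_iff' measurableSet_Ioo).2 (.of_forall hφ_nonneg)
  · intro r hr
    have hr0 := hr.1
    simp only [← ENNReal.ofReal_mul (show 0 ≤ (n + 1 : ℝ) ^ 2 * r ^ (2 * n) by positivity),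
      ← ENNReal.ofReal_mul (show 0 ≤ 2 * r by positivity), φ, Real.log_pow]
    push_cast
    ring_nf

theorem lintegral_norm_deriv_sq_mul_log {g : ℂ → ℂ} (hg : DifferentiableOn ℂ g disc) :
    ∫⁻ z, ENNReal.ofReal (‖deriv g z‖ ^ 2) * ENNReal.ofReal (-Real.log (‖z‖ ^ 2)) ∂area =
      ∑' n, ENNReal.ofReal (‖coeff g (n + 1)‖ ^ 2) := by
  have hcoeff : ∀ (n : ℕ) (r : ℝ), ENNReal.ofReal (‖coeff (deriv g) n‖ ^ 2 * r ^ (2 * n)) =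
      ENNReal.ofReal (‖coeff g (n + 1)‖ ^ 2) * ENNReal.ofReal ((n + 1) ^ 2 * r ^ (2 * n)) := by
    intro n r
    rw [← ENNReal.ofReal_mul (by positivity), coeff_deriv, norm_mul,
      show ‖(n + 1 : ℂ)‖ = n + 1 by exact_mod_cast Complex.norm_natCast (n + 1)]
    ring_nf
  have hcircle : ∀ r ∈ Ioo (0 : ℝ) 1,
      ENNReal.ofReal (2 * r) * ∫⁻ ζ, ENNReal.ofReal (‖deriv g (r * ζ)‖ ^ 2) *
        ENNReal.ofReal (-Real.log (‖(r * ζ : ℂ)‖ ^ 2)) ∂m =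
      ∑' n : ℕ, ENNReal.ofReal (‖coeff g (n + 1)‖ ^ 2) * (ENNReal.ofReal (2 * r) *
        (ENNReal.ofReal ((n + 1) ^ 2 * r ^ (2 * n)) * ENNReal.ofReal (-Real.log (r ^ 2)))) := by
    intro r hr
    have hlog : ∫⁻ ζ, ENNReal.ofReal (‖deriv g (r * ζ)‖ ^ 2) *
        ENNReal.ofReal (-Real.log (‖(r * ζ : ℂ)‖ ^ 2)) ∂m =
        (∫⁻ ζ, ENNReal.ofReal (‖deriv g (r * ζ)‖ ^ 2) ∂m) *
          ENNReal.ofReal (-Real.log (r ^ 2)) := by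
      rw [← lintegral_mul_const _ (by fun_prop)]
      refine lintegral_congr_ae ?_
      filter_upwards [ae_m_norm_eq_one] with ζ hζ
      simp [hζ]
    rw [hlog, lintegral_radial_norm_sq (hg.deriv isOpen_disc) hr.1.le hr.2,
      ← ENNReal.tsum_mul_right, ← ENNReal.tsum_mul_left]
    exact tsum_congr fun n => by rw [hcoeff]; ring
  rw [lintegral_area_eq_polar (by fun_prop), setLIntegral_congr_fun measurableSet_Ioo hcircle,
    lintegral_tsum fun n => by fun_prop]
  refine tsum_congr fun n => ?_
  rw [lintegral_const_mul _ (by fun_prop), lintegral_pow_mul_log, mul_one]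

/-! ### Disc automorphisms -/

/-- The involutive automorphism of the unit disc exchanging `0` and `w`. -/
noncomputable def mobius (w z : ℂ) : ℂ := (w - z) / (1 - conj w * z)

theorem one_sub_conj_mul_ne_zero {w z : ℂ} (h : ‖w‖ * ‖z‖ < 1) : 1 - conj w * z ≠ 0 := by
  intro h0
  have : ‖conj w * z‖ = 1 := by rw [← sub_eq_zero.1 h0, norm_one]
  rw [norm_mul, RCLike.norm_conj] at this
  linarith

theorem norm_mul_norm_lt_one {w z : ℂ} (hw : w ∈ disc) (hz : ‖z‖ ≤ 1) : ‖w‖ * ‖z‖ < 1 := by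
  have := mem_disc.1 hw
  nlinarith [norm_nonneg z, norm_nonneg w]

theorem norm_one_sub_conj_mul_sq (w z : ℂ) :
    ‖1 - conj w * z‖ ^ 2 - ‖w - z‖ ^ 2 = (1 - ‖w‖ ^ 2) * (1 - ‖z‖ ^ 2) := by
  simp only [← Complex.normSq_eq_norm_sq, Complex.normSq_apply]
  simp only [Complex.sub_re, Complex.one_re, Complex.mul_re, Complex.conj_re, Complex.conj_im,
    neg_mul, sub_neg_eq_add, Complex.sub_im, Complex.one_im, Complex.mul_im, zero_sub,
    neg_add_rev, neg_neg]
  ring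

theorem one_sub_norm_mobius_sq {w z : ℂ} (h : 1 - conj w * z ≠ 0) :
    1 - ‖mobius w z‖ ^ 2 = (1 - ‖w‖ ^ 2) * (1 - ‖z‖ ^ 2) / ‖1 - conj w * z‖ ^ 2 := by
  have h' : ‖1 - conj w * z‖ ≠ 0 := norm_ne_zero_iff.2 h
  rw [← norm_one_sub_conj_mul_sq, mobius, norm_div, div_pow, eq_div_iff (pow_ne_zero 2 h'), sub_mul,
    div_mul_cancel₀ _ (pow_ne_zero 2 h')]
  ring

theorem mobius_mem_disc {w z : ℂ} (hw : w ∈ disc) (hz : z ∈ disc) : mobius w z ∈ disc := by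
  have h1 := mem_disc.1 hw
  have h2 := mem_disc.1 hz
  have h := one_sub_norm_mobius_sq (one_sub_conj_mul_ne_zero (norm_mul_norm_lt_one hw h2.le))
  have h3 : 0 < ‖1 - conj w * z‖ :=
    norm_pos_iff.2 (one_sub_conj_mul_ne_zero (norm_mul_norm_lt_one hw h2.le))
  have h4 : 0 < 1 - ‖w‖ ^ 2 := by nlinarith [norm_nonneg w]
  have h5 : 0 < 1 - ‖z‖ ^ 2 := by nlinarith [norm_nonneg z]
  have : 0 < 1 - ‖mobius w z‖ ^ 2 := by rw [h]; positivity
  simp only [disc, Metric.mem_ball, dist_zero_right]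
  nlinarith [norm_nonneg (mobius w z)]

theorem norm_mobius_eq_one {w z : ℂ} (hw : w ∈ disc) (hz : ‖z‖ = 1) : ‖mobius w z‖ = 1 := by
  have h := one_sub_norm_mobius_sq (one_sub_conj_mul_ne_zero (norm_mul_norm_lt_one hw hz.le))
  rw [hz, one_pow, sub_self, mul_zero, zero_div] at h
  nlinarith [norm_nonneg (mobius w z), sq_nonneg (‖mobius w z‖ - 1)]

theorem mobius_mobius {w z : ℂ} (hw : w ∈ disc) (hz : z ∈ disc) : mobius w (mobius w z) = z := by
  have h1 : 1 - conj w * z ≠ 0 :=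
    one_sub_conj_mul_ne_zero (norm_mul_norm_lt_one hw (mem_disc.1 hz).le)
  have h2 : 1 - conj w * mobius w z ≠ 0 := one_sub_conj_mul_ne_zero
    (norm_mul_norm_lt_one hw (mem_disc.1 (mobius_mem_disc hw hz)).le)
  have h3 : mobius w z * (1 - conj w * z) = w - z := div_mul_cancel₀ _ h1
  rw [mobius, div_eq_iff h2]
  linear_combination -h3

theorem mobius_zero (w : ℂ) : mobius w 0 = w := by simp [mobius]

theorem image_mobius_disc {w : ℂ} (hw : w ∈ disc) : mobius w '' disc = disc := by
  refine Subset.antisymm (image_subset_iff.2 fun z hz => mobius_mem_disc hw hz)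
    fun z hz => ⟨mobius w z, mobius_mem_disc hw hz, mobius_mobius hw hz⟩

theorem injOn_mobius {w : ℂ} (hw : w ∈ disc) : InjOn (mobius w) disc := fun a ha b hb h => by
  rw [← mobius_mobius hw ha, h, mobius_mobius hw hb]

theorem differentiableAt_mobius {w z : ℂ} (h : ‖w‖ * ‖z‖ < 1) :
    DifferentiableAt ℂ (mobius w) z := by
  unfold mobius
  exact DifferentiableAt.fun_div (by fun_prop) (by fun_prop) (one_sub_conj_mul_ne_zero h)

@[fun_prop]
theorem measurable_mobius (w : ℂ) : Measurable (mobius w) := by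
  unfold mobius; fun_prop

theorem greenKernel_mobius {w z : ℂ} (hw : w ∈ disc) (hz : z ∈ disc) (h0 : z ≠ 0) :
    greenKernel (mobius w z) w = ENNReal.ofReal (-Real.log (‖z‖ ^ 2)) := by
  have hne : mobius w z ≠ w := fun h => h0 <| injOn_mobius hw hz
    zero_mem_disc (by rw [h, mobius_zero])
  rw [greenKernel, if_neg hne]
  have : ‖(1 - conj w * mobius w z) / (mobius w z - w)‖ = ‖z‖⁻¹ := by
    rw [← norm_neg, ← div_neg, neg_sub]
    conv_rhs => rw [← mobius_mobius hw hz, mobius, ← norm_inv, inv_div]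
  rw [this, inv_pow, Real.log_inv]

theorem lintegral_norm_deriv_sq_mul_greenKernel {f : ℂ → ℂ} (hf : DifferentiableOn ℂ f disc) {w : ℂ}
    (hw : w ∈ disc) :
    ∫⁻ z, ENNReal.ofReal (‖deriv f z‖ ^ 2) * greenKernel z w ∂area =
      ∫⁻ z, ENNReal.ofReal (‖deriv (fun z => f (mobius w z)) z‖ ^ 2) *
        ENNReal.ofReal (-Real.log (‖z‖ ^ 2)) ∂area := by
  rw [area, lintegral_smul_measure, lintegral_smul_measure]
  congr 1
  have hd : ∀ z ∈ disc, DifferentiableAt ℂ (mobius w) z := fun z hz =>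
    differentiableAt_mobius (norm_mul_norm_lt_one hw (mem_disc.1 hz).le)
  have hF : ∀ z ∈ disc, HasFDerivWithinAt (mobius w)
      ((ContinuousLinearMap.toSpanSingleton ℂ (deriv (mobius w) z)).restrictScalars ℝ) disc z :=
    fun z hz => ((hd z hz).hasDerivAt.hasFDerivAt.restrictScalars ℝ).hasFDerivWithinAt
  have hcv := lintegral_image_eq_lintegral_abs_det_fderiv_mul volume measurableSet_disc hF
    (injOn_mobius hw) fun z => ENNReal.ofReal (‖deriv f z‖ ^ 2) * greenKernel z w
  rw [image_mobius_disc hw] at hcv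
  rw [hcv]
  refine lintegral_congr_ae ?_
  have hne : ∀ᵐ z ∂(volume.restrict disc), z ≠ (0 : ℂ) :=
    ae_restrict_of_ae (by simp [ae_iff])
  filter_upwards [ae_restrict_mem measurableSet_disc, hne] with z hz h0
  have hchain : deriv (fun z => f (mobius w z)) z =
      deriv f (mobius w z) * deriv (mobius w) z :=
    deriv_comp z (hf.differentiableAt (Metric.isOpen_ball.mem_nhds (mobius_mem_disc hw hz)))
      (hd z hz)
  have hdet : |((ContinuousLinearMap.toSpanSingleton ℂ
      (deriv (mobius w) z)).restrictScalars ℝ).det| = ‖deriv (mobius w) z‖ ^ 2 := by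
    simp [ContinuousLinearMap.det, LinearMap.det_restrictScalars, Algebra.norm_complex_eq,
      Complex.normSq_eq_norm_sq]
  rw [greenKernel_mobius hw hz h0, hchain, hdet, ← mul_assoc, ← ENNReal.ofReal_mul (by positivity),
    norm_mul, mul_pow, mul_comm (‖deriv (mobius w) z‖ ^ 2)]

theorem diffContOnCl_mobius {w : ℂ} (hw : w ∈ disc) :
    DiffContOnCl ℂ (mobius w) (Metric.ball 0 1) := by
  refine DifferentiableOn.diffContOnCl fun z hz => ?_
  rw [closure_ball _ one_ne_zero] at hz
  exact (differentiableAt_mobius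
    (norm_mul_norm_lt_one hw (by simpa using hz))).differentiableWithinAt

theorem integral_inner_pow_eq {ν ν' : Measure ℂ} [IsFiniteMeasure ν] [IsFiniteMeasure ν']
    (hν : ∀ᵐ ζ ∂ν, ‖ζ‖ = 1) (hν' : ∀ᵐ ζ ∂ν', ‖ζ‖ = 1)
    (h : ∀ n : ℕ, ∫ ζ, ζ ^ n ∂ν = ∫ ζ, ζ ^ n ∂ν') (t : ℂ) (n : ℕ) :
    ∫ ζ, (inner ℝ ζ t : ℂ) ^ n ∂ν = ∫ ζ, (inner ℝ ζ t : ℂ) ^ n ∂ν' := by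
  have hinner : ∀ ζ : ℂ, (inner ℝ ζ t : ℂ) ^ n = ∑ k ∈ Finset.range (n + 1),
      (2⁻¹ ^ n * t ^ k * conj t ^ (n - k) * n.choose k) * (conj ζ ^ k * ζ ^ (n - k)) := by
    intro ζ
    have hreal : (inner ℝ ζ t : ℂ) = 2⁻¹ * (conj ζ * t + ζ * conj t) := by
      apply Complex.ext <;> simp [Complex.inner] <;> ring
    rw [hreal, mul_pow, add_pow, Finset.mul_sum]
    exact Finset.sum_congr rfl fun k _ => by ring
  have hint : ∀ (ρ : Measure ℂ) [IsFiniteMeasure ρ], (∀ᵐ ζ ∂ρ, ‖ζ‖ = 1) → ∀ (c : ℂ) (i j : ℕ),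
      Integrable (fun ζ : ℂ => c * (conj ζ ^ i * ζ ^ j)) ρ := by
    intro ρ _ hρ c i j
    refine .of_bound (Continuous.aestronglyMeasurable (by fun_prop)) ‖c‖ ?_
    filter_upwards [hρ] with ζ hζ
    simp [hζ]
  simp_rw [hinner]
  rw [integral_finsetSum _ fun k _ => hint ν hν _ _ _,
    integral_finsetSum _ fun k _ => hint ν' hν' _ _ _]
  refine Finset.sum_congr rfl fun k _ => ?_
  simp_rw [integral_const_mul, integral_conj_pow_mul_pow hν, integral_conj_pow_mul_pow hν', h]

theorem hasSum_charFun {ν : Measure ℂ} [IsFiniteMeasure ν] (hν : ∀ᵐ ζ ∂ν, ‖ζ‖ = 1) (t : ℂ) :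
    HasSum (fun n : ℕ => Complex.I ^ n / n.factorial * ∫ ζ, (inner ℝ ζ t : ℂ) ^ n ∂ν)
      (charFun ν t) := by
  have hterm : ∀ n : ℕ, Complex.I ^ n / n.factorial * ∫ ζ, (inner ℝ ζ t : ℂ) ^ n ∂ν =
      ∫ ζ, ((inner ℝ ζ t : ℂ) * Complex.I) ^ n / n.factorial ∂ν := fun n => by
    rw [← integral_const_mul]
    congr with ζ
    ring
  simp_rw [hterm, charFun_apply]
  refine hasSum_integral_of_dominated_convergence (fun n _ => ‖t‖ ^ n / n.factorial)
    (fun n => Continuous.aestronglyMeasurable (by fun_prop)) (fun n => ?_)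
    (.of_forall fun _ => Real.summable_pow_div_factorial ‖t‖) (integrable_const _)
    (.of_forall fun ζ => ?_)
  · filter_upwards [hν] with ζ hζ
    have hle : |inner ℝ ζ t| ≤ ‖t‖ := by simpa [hζ] using abs_real_inner_le_norm ζ t
    rw [norm_div, norm_pow, norm_mul, Complex.norm_I, mul_one, Complex.norm_real, Real.norm_eq_abs,
      Complex.norm_natCast]
    gcongr
  · rw [Complex.exp_eq_exp_ℂ]
    exact NormedSpace.expSeries_div_hasSum_exp _

theorem ext_of_integral_pow_eq {ν ν' : Measure ℂ} [IsFiniteMeasure ν] [IsFiniteMeasure ν']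
    (hν : ∀ᵐ ζ ∂ν, ‖ζ‖ = 1) (hν' : ∀ᵐ ζ ∂ν', ‖ζ‖ = 1)
    (h : ∀ n : ℕ, ∫ ζ, ζ ^ n ∂ν = ∫ ζ, ζ ^ n ∂ν') : ν = ν' := by
  refine Measure.ext_of_charFun (funext fun t => (hasSum_charFun hν t).unique ?_)
  simp_rw [integral_inner_pow_eq hν hν' h t]
  exact hasSum_charFun hν' t

theorem map_mobius_σ {w z : ℂ} (hw : w ∈ disc) (hz : z ∈ disc) :
    (σ z).map (mobius w) = σ (mobius w z) := by
  have := isProbabilityMeasure_σ hz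
  have := isProbabilityMeasure_σ (mobius_mem_disc hw hz)
  have hcircle : ∀ᵐ ζ ∂(σ z).map (mobius w), ‖ζ‖ = 1 := by
    refine (ae_map_iff (by fun_prop) (measurableSet_eq_fun (by fun_prop) (by fun_prop))).2 ?_
    filter_upwards [ae_σ_norm_eq_one z] with ζ hζ using norm_mobius_eq_one hw hζ
  refine ext_of_integral_pow_eq hcircle (ae_σ_norm_eq_one _) fun n => ?_
  rw [integral_map (by fun_prop) (by fun_prop), integral_pow_σ (mobius_mem_disc hw hz)]
  exact integral_σ_of_diffContOnCl
    ((differentiable_pow n).comp_diffContOnCl (diffContOnCl_mobius hw)) hz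

/-! ### The Bregman divergence of the exponential function -/

theorem F_nonneg (x y : ℝ) : 0 ≤ F x y := by
  have h : F x y = Real.exp y * (Real.exp (x - y) - (x - y + 1)) := by
    rw [mul_sub, ← Real.exp_add, add_sub_cancel, F]
    ring
  rw [h]
  exact mul_nonneg (Real.exp_pos y).le (sub_nonneg.2 (Real.add_one_le_exp _))

section

variable {Ω : Type*} [MeasurableSpace Ω] {ν : Measure Ω} [IsProbabilityMeasure ν] {k : Ω → ℝ}

theorem integral_F (hk : Integrable k ν) (hexp : Integrable (fun ω => Real.exp (k ω)) ν) (a : ℝ) :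
    ∫ ω, F (k ω) a ∂ν = ∫ ω, Real.exp (k ω) ∂ν - Real.exp (∫ ω, k ω ∂ν) + F (∫ ω, k ω ∂ν) a := by
  have hdiff : Integrable (fun ω => Real.exp (k ω) - Real.exp a) ν :=
    hexp.sub (integrable_const _)
  have hlin : Integrable (fun ω => Real.exp a * (k ω - a)) ν :=
    (hk.sub (integrable_const a)).const_mul _
  simp only [F]
  rw [integral_sub hdiff hlin, integral_sub hexp (integrable_const _),
    integral_const_mul, integral_sub hk (integrable_const a)]
  simp only [integral_const, probReal_univ, one_smul]
  ring

theorem integrable_F_iff (hk : Integrable k ν) (a : ℝ) :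
    Integrable (fun ω => F (k ω) a) ν ↔ Integrable (fun ω => Real.exp (k ω)) ν := by
  have hlin : Integrable (fun ω => Real.exp a + Real.exp a * (k ω - a)) ν :=
    (integrable_const _).add ((hk.sub (integrable_const a)).const_mul _)
  rw [← integrable_add_iff_integrable_left hlin]
  exact iff_of_eq (congrArg (Integrable · ν) (funext fun ω => by simp only [F, Pi.add_apply]; ring))

theorem lintegral_F_add (hk : Integrable k ν) (a : ℝ) :
    ∫⁻ ω, ENNReal.ofReal (F (k ω) a) ∂ν + ENNReal.ofReal (Real.exp (∫ ω, k ω ∂ν)) =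
      ∫⁻ ω, ENNReal.ofReal (Real.exp (k ω)) ∂ν + ENNReal.ofReal (F (∫ ω, k ω ∂ν) a) := by
  have hF0 : 0 ≤ᵐ[ν] fun ω => F (k ω) a := .of_forall fun _ => F_nonneg _ _
  have hexp0 : 0 ≤ᵐ[ν] fun ω => Real.exp (k ω) := .of_forall fun _ => (Real.exp_pos _).le
  by_cases hexp : Integrable (fun ω => Real.exp (k ω)) ν
  · rw [← ofReal_integral_eq_lintegral_ofReal hexp hexp0,
      ← ofReal_integral_eq_lintegral_ofReal ((integrable_F_iff hk a).2 hexp) hF0,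
      ← ENNReal.ofReal_add (integral_nonneg_of_ae hF0) (Real.exp_pos _).le,
      ← ENNReal.ofReal_add (integral_nonneg_of_ae hexp0) (F_nonneg _ _), integral_F hk hexp]
    congr 1
    ring
  · have hexp_top : ∫⁻ ω, ENNReal.ofReal (Real.exp (k ω)) ∂ν = ⊤ := by
      by_contra h
      exact hexp ((lintegral_ofReal_ne_top_iff_integrable
        (Real.continuous_exp.comp_aestronglyMeasurable hk.1) hexp0).1 h)
    have hF_top : ∫⁻ ω, ENNReal.ofReal (F (k ω) a) ∂ν = ⊤ := by
      by_contra h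
      have hF : Continuous fun x => F x a := by unfold F; fun_prop
      exact hexp ((integrable_F_iff hk a).1 ((lintegral_ofReal_ne_top_iff_integrable
        (hF.comp_aestronglyMeasurable hk.1) hF0).1 h))
    rw [hexp_top, hF_top, top_add, top_add]

theorem iInf_lintegral_F_add (hk : Integrable k ν) :
    (⨅ a : ℝ, ∫⁻ ω, ENNReal.ofReal (F (k ω) a) ∂ν) + ENNReal.ofReal (Real.exp (∫ ω, k ω ∂ν)) =
      ∫⁻ ω, ENNReal.ofReal (Real.exp (k ω)) ∂ν := by
  have hmin : ⨅ a : ℝ, ENNReal.ofReal (F (∫ ω, k ω ∂ν) a) = 0 :=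
    le_antisymm ((iInf_le _ (∫ ω, k ω ∂ν)).trans_eq (by simp [F])) zero_le
  simp_rw [ENNReal.iInf_add, lintegral_F_add hk, ← ENNReal.add_iInf, hmin, add_zero]

theorem ofReal_exp_integral_le (hk : Integrable k ν) :
    ENNReal.ofReal (Real.exp (∫ ω, k ω ∂ν)) ≤ ∫⁻ ω, ENNReal.ofReal (Real.exp (k ω)) ∂ν :=
  le_add_self.trans_eq (iInf_lintegral_F_add hk)

end

/-! ### Functions whose log-modulus is a Poisson integral -/

section

variable {g : ℂ → ℂ} {k : ℂ → ℝ}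

theorem tsum_norm_coeff_sq_eq (hg : DifferentiableOn ℂ g disc) (hk : Integrable k m)
    (hgk : ∀ z ∈ disc, ‖g z‖ ^ 2 = Real.exp (∫ ζ, k ζ ∂(σ z))) :
    ∑' n, ENNReal.ofReal (‖coeff g n‖ ^ 2) = ∫⁻ ζ, ENNReal.ofReal (Real.exp (k ζ)) ∂m := by
  refine le_antisymm (tsum_norm_coeff_sq_le hg fun r hr => ?_)
    (lintegral_radialLimit_norm_sq_le hg ?_)
  · calc ∫⁻ ζ, ENNReal.ofReal (‖g (r * ζ)‖ ^ 2) ∂m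
        ≤ ∫⁻ ζ, ∫⁻ ξ, ENNReal.ofReal (Real.exp (k ξ)) ∂(σ (r * ζ)) ∂m := by
          refine lintegral_mono_ae ?_
          filter_upwards [ae_m_norm_eq_one] with ζ hζ
          have hrζ := radial_mem_disc hr.1.le hr.2 hζ
          have := isProbabilityMeasure_σ hrζ
          rw [hgk _ hrζ]
          exact ofReal_exp_integral_le (integrable_σ hrζ hk)
      _ = ∫⁻ ζ, ENNReal.ofReal (Real.exp (k ζ)) ∂m :=
          lintegral_lintegral_σ_radial hr.1.le hr.2
            (Real.measurable_exp.comp_aemeasurable hk.aemeasurable).ennreal_ofReal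
  · filter_upwards [ae_tendsto_integral_σ_radial hk, ae_m_norm_eq_one] with ζ hlim hζ
    refine ((Real.continuous_exp.tendsto _).comp hlim).congr' ?_
    filter_upwards [Ioo_zero_one_mem] with r hr
    exact (hgk _ (radial_mem_disc hr.1.le hr.2 hζ)).symm

theorem lintegral_norm_deriv_sq_mul_log_add (hg : DifferentiableOn ℂ g disc) (hk : Integrable k m)
    (hgk : ∀ z ∈ disc, ‖g z‖ ^ 2 = Real.exp (∫ ζ, k ζ ∂(σ z))) :
    ∫⁻ z, ENNReal.ofReal (‖deriv g z‖ ^ 2) * ENNReal.ofReal (-Real.log (‖z‖ ^ 2)) ∂area +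
        ENNReal.ofReal (‖g 0‖ ^ 2) = ∫⁻ ζ, ENNReal.ofReal (Real.exp (k ζ)) ∂m := by
  rw [lintegral_norm_deriv_sq_mul_log hg, ← tsum_norm_coeff_sq_eq hg hk hgk, ← coeff_zero g,
    add_comm]
  exact (tsum_eq_zero_add' (f := fun n => ENNReal.ofReal (‖coeff g n‖ ^ 2))
    ENNReal.summable).symm

theorem lintegral_norm_deriv_sq_mul_greenKernel_add (hg : DifferentiableOn ℂ g disc)
    (hk : Integrable k m) (hgk : ∀ z ∈ disc, ‖g z‖ ^ 2 = Real.exp (∫ ζ, k ζ ∂(σ z)))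
    {w : ℂ} (hw : w ∈ disc) :
    ∫⁻ z, ENNReal.ofReal (‖deriv g z‖ ^ 2) * greenKernel z w ∂area +
        ENNReal.ofReal (‖g w‖ ^ 2) = ∫⁻ ζ, ENNReal.ofReal (Real.exp (k ζ)) ∂(σ w) := by
  have hmap : m.map (mobius w) = σ w := by
    rw [← σ_zero, map_mobius_σ hw zero_mem_disc, mobius_zero]
  have hkw : Integrable k (m.map (mobius w)) := hmap ▸ integrable_σ hw hk
  have hgw : DifferentiableOn ℂ (fun z => g (mobius w z)) disc :=
    hg.comp (diffContOnCl_mobius hw).differentiableOn fun z => mobius_mem_disc hw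
  have hgkw : ∀ z ∈ disc, ‖g (mobius w z)‖ ^ 2 = Real.exp (∫ ζ, k (mobius w ζ) ∂(σ z)) := by
    intro z hz
    have hmz := mobius_mem_disc hw hz
    have hkz : Integrable k ((σ z).map (mobius w)) := map_mobius_σ hw hz ▸ integrable_σ hmz hk
    rw [hgk _ hmz, ← map_mobius_σ hw hz, integral_map (by fun_prop) hkz.1]
  have h := lintegral_norm_deriv_sq_mul_log_add hgw (hkw.comp_measurable (by fun_prop)) hgkw
  rw [mobius_zero] at h
  rw [lintegral_norm_deriv_sq_mul_greenKernel hg hw, h, ← hmap]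
  exact (lintegral_map' (Real.measurable_exp.comp_aemeasurable hkw.aemeasurable).ennreal_ofReal
    (by fun_prop)).symm

theorem lintegral_norm_deriv_sq_mul_greenKernel_eq_iInf (hg : DifferentiableOn ℂ g disc)
    (hk : Integrable k m) (hgk : ∀ z ∈ disc, ‖g z‖ ^ 2 = Real.exp (∫ ζ, k ζ ∂(σ z)))
    {w : ℂ} (hw : w ∈ disc) :
    ∫⁻ z, ENNReal.ofReal (‖deriv g z‖ ^ 2) * greenKernel z w ∂area =
      ⨅ a : ℝ, ∫⁻ ζ, ENNReal.ofReal (F (k ζ) a) ∂(σ w) := by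
  have := isProbabilityMeasure_σ hw
  have h := lintegral_norm_deriv_sq_mul_greenKernel_add hg hk hgk hw
  rw [← iInf_lintegral_F_add (integrable_σ hw hk), hgk w hw] at h
  exact (ENNReal.add_left_inj ENNReal.ofReal_ne_top).1 h

end

theorem lintegral_norm_deriv_sq_mul_greenKernel_eq_iInf_boundaryValue {h : ℂ → ℝ}
    (hh : Integrable h m) {f : ℂ → ℂ} {α : ℂ} (hα : ‖α‖ = 1)
    (hf : ∀ z ∈ disc, f z = α * Complex.exp (herglotz h z)) {w : ℂ} (hw : w ∈ disc) :
    ∫⁻ z, ENNReal.ofReal (‖deriv f z‖ ^ 2) * greenKernel z w ∂area =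
      ⨅ a : ℝ, ∫⁻ ζ, ENNReal.ofReal (F (2 * Real.log ‖boundaryValue f ζ‖) a) ∂(σ w) := by
  have hdiff : DifferentiableOn ℂ f disc :=
    ((differentiableOn_herglotz hh).cexp.const_mul α).congr hf
  have hnorm : ∀ z ∈ disc, ‖f z‖ ^ 2 = Real.exp (∫ ζ, 2 * h ζ ∂(σ z)) := fun z hz => by
    rw [hf z hz, norm_mul, hα, one_mul, norm_exp_herglotz hh hz, integral_const_mul, two_mul,
      Real.exp_add, sq]
  rw [lintegral_norm_deriv_sq_mul_greenKernel_eq_iInf hdiff (hh.const_mul 2) hnorm hw]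
  refine iInf_congr fun a => lintegral_congr_ae ?_
  filter_upwards [(σ_absolutelyContinuous w).ae_le (ae_norm_boundaryValue_eq_exp hh hα hf)]
    with ζ hζ
  rw [hζ, Real.log_exp]

/-! ### Integration over the poles -/

theorem measurable_greenKernel : Measurable fun p : ℂ × ℂ => greenKernel p.1 p.2 := by
  have hconj : Measurable fun z : ℂ => conj z := Complex.continuous_conj.measurable
  unfold greenKernel
  exact Measurable.ite (measurableSet_eq_fun (by fun_prop) (by fun_prop)) measurable_const
    (by fun_prop)

theorem dirichletIntegral_greenPotential {μ : Measure ℂ} [SFinite (μ.restrict disc)] (f : ℂ → ℂ) :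
    dirichletIntegral (greenPotential μ) f =
      ∫⁻ w in disc, ∫⁻ z, ENNReal.ofReal (‖deriv f z‖ ^ 2) * greenKernel z w ∂area ∂μ := by
  have : SFinite area := by unfold area; infer_instance
  have hderiv : Measurable fun z => ENNReal.ofReal (‖deriv f z‖ ^ 2) := by fun_prop
  have hgreen : ∀ z, Measurable (greenKernel z) := fun z =>
    measurable_greenKernel.comp measurable_prodMk_left
  simp only [dirichletIntegral, greenPotential]
  simp_rw [← lintegral_const_mul _ (hgreen _)]
  exact lintegral_lintegral_swap
    ((hderiv.comp measurable_fst).mul measurable_greenKernel).aemeasurable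

theorem sFinite_restrict_disc {μ : Measure ℂ}
    (hμ : ∫⁻ w in disc, ENNReal.ofReal (1 - ‖w‖ ^ 2) ∂μ < ⊤) : SFinite (μ.restrict disc) := by
  have : IsFiniteMeasure
      ((μ.restrict disc).withDensity fun w => ENNReal.ofReal (1 - ‖w‖ ^ 2)) :=
    isFiniteMeasure_withDensity hμ.ne
  have hpos : ∀ᵐ w ∂(μ.restrict disc), ENNReal.ofReal (1 - ‖w‖ ^ 2) ≠ 0 := by
    filter_upwards [ae_restrict_mem measurableSet_disc] with w hw
    have hsq : ‖w‖ ^ 2 < 1 := pow_lt_one₀ (norm_nonneg w) (mem_disc.1 hw) two_ne_zero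
    exact (ENNReal.ofReal_pos.2 (sub_pos.2 hsq)).ne'
  rw [← withDensity_inv_same (by fun_prop) hpos (.of_forall fun _ => ENNReal.ofReal_ne_top)]
  infer_instance

end DirichletOuter

theorem theorem2p2_general (μ : Measure ℂ) [SFinite (μ.restrict DirichletOuter.disc)]
    {h : ℂ → ℝ} (hh : Integrable h DirichletOuter.m) {f : ℂ → ℂ} {α : ℂ} (hα : ‖α‖ = 1)
    (hf : ∀ z ∈ DirichletOuter.disc, f z = α * Complex.exp (DirichletOuter.herglotz h z)) :
    DirichletOuter.dirichletIntegral (DirichletOuter.greenPotential μ) f =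
      ∫⁻ w in DirichletOuter.disc,
        (⨅ a : ℝ, ∫⁻ ζ, ENNReal.ofReal
          (DirichletOuter.F (2 * Real.log ‖DirichletOuter.boundaryValue f ζ‖) a)
            ∂(DirichletOuter.σ w)) ∂μ := by
  rw [DirichletOuter.dirichletIntegral_greenPotential]
  exact setLIntegral_congr_fun DirichletOuter.measurableSet_disc fun w hw =>
    DirichletOuter.lintegral_norm_deriv_sq_mul_greenKernel_eq_iInf_boundaryValue hh hα hf hw

theorem theorem2p2 (μ : MeasureTheory.Measure ℂ)
    (hμ : ∫⁻ w in DirichletOuter.disc, ENNReal.ofReal (1 - ‖w‖ ^ 2) ∂μ < ⊤)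
    (f : ℂ → ℂ) (hf : DirichletOuter.MemHardy 2 f) (hout : DirichletOuter.IsOuter f) :
    DirichletOuter.dirichletIntegral (DirichletOuter.greenPotential μ) f =
      ∫⁻ w in DirichletOuter.disc,
        (⨅ a : ℝ, ∫⁻ ζ, ENNReal.ofReal
          (DirichletOuter.F (2 * Real.log ‖DirichletOuter.boundaryValue f ζ‖) a)
            ∂(DirichletOuter.σ w)) ∂μ := by
  obtain ⟨-, α, h, hα, hh, hrep⟩ := hout
  have := DirichletOuter.sFinite_restrict_disc hμ
  exact theorem2p2_general μ hh hα hrep
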